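/- Let $n\ge 1$. For a smooth embedded hypersurface $\Sigma\subset\mathbb R^{n+1}$ with unit normal field $\mathsf N$, its Gaussian curvature at $x$ is $\det(D\mathsf N(x)|_{T_x\Sigma})$. The boundary of a convex set is oriented by the outward-pointing unit normal. Let $\chi\in C_0^\infty(\mathbb R^{n+1})$ satisfy $\chi\ge 0$, $\chi=0$ outside the open unit ball, and $\int\chi=1$; for a continuous function $f$ on $\mathbb R^{n+1}$ and $s>0$, put $$f_s(x)=\int_{\mathbb R^{n+1}} f(x-y)\,s^{n+1}\chi(sy)\,dy .$$ Let $K_1,K_2\subset\mathbb R^{n+1}$ be compact convex sets whose intersection $K=K_1\cap K_2$ has non-empty interior, let $U\subset\mathbb R^{n+1}$ be open, let $k>0$, and suppose that $U\cap\partial K_1$ and $U\cap\partial K_2$ are smooth hypersurfaces of Gaussian curvature at least $k$ at every point. Let $d(x)=\inf_{y\in K}\|x-y\|$. Then for every compact $X\subset U$ and every $\varepsilon>0$ there exists $\rho>0$ such that for every $r\in(0,\rho)$ there exists $S>0$ such that for every $s>S$: (a) for every $x\in X$ with $d_s(x)=r$, the level set $\{d_s=r\}$ is a smooth hypersurface near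 $x$, and its Gaussian curvature at $x$, with respect to the outward normal of $\{d_s\le r\}$, is at least $k-\varepsilon$; (b) the set $\{d_s\le r\}$ is compact and convex, has boundary $\{d_s=r\}$, contains $K$, and lies at Hausdorff distance at most $2r$ from $K$. In particular, $K$ is a limit, in the Hausdorff sense, of compact convex sets whose boundaries are, at their points in $X$, smooth of Gaussian curvature at least $k-\varepsilon$. -/

import Mathlib

open scoped ContDiff

namespace ConvexIntersection

/-- Euclidean space of dimension `n + 1`. -/
abbrev E (n : ℕ) : Type := EuclideanSpace ℝ (Fin (n + 1))

/-- Near the point `x`, the set `S` is a smooth embedded hypersurface: in some open neighbourhood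
`V` of `x` it is the zero set of a smooth function without critical points. -/
def IsSmoothHypersurfaceNear {n : ℕ} (S : Set (E n)) (x : E n) : Prop :=
  ∃ V : Set (E n), IsOpen V ∧ x ∈ V ∧ ∃ f : E n → ℝ, ContDiffOn ℝ ∞ f V ∧
    (∀ y ∈ V, fderiv ℝ f y ≠ 0) ∧ S ∩ V = {y ∈ V | f y = 0}

/-- `ν` is a supporting normal of the convex set `K` at its point `x`. -/
def IsSupportingNormal {n : ℕ} (K : Set (E n)) (x ν : E n) : Prop :=
  ‖ν‖ = 1 ∧ ∀ y ∈ K, inner ℝ (y - x) ν ≤ 0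

/-- The outward-pointing unit normal of a closed convex set `K`. At a boundary point near which
the boundary of a convex set with non-empty interior is a smooth hypersurface, it is the unique
supporting normal; the value is of no significance at points where a supporting normal does not
exist or is not unique. -/
noncomputable def outwardNormal {n : ℕ} (K : Set (E n)) (x : E n) : E n :=
  Classical.epsilon (IsSupportingNormal K x)

/-- The shape operator at `x` of the hypersurface `S` with unit normal field `ν`: the derivative
`v ↦ Dν(x) v` of `ν` along `S`, on the tangent space of `S` at `x`, which is the orthogonal
complement of `ν x`. The derivative within `S` is determined on tangent vectors, and maps these to
tangent vectors because `ν` has unit length on `S`; the projection only serves to express this. -/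
noncomputable def shapeOperator {n : ℕ} (S : Set (E n)) (ν : E n → E n) (x : E n) :
    (ℝ ∙ ν x)ᗮ →ₗ[ℝ] (ℝ ∙ ν x)ᗮ :=
  ((ℝ ∙ ν x)ᗮ.orthogonalProjectionOnto.comp
    ((fderivWithin ℝ ν S x).comp (ℝ ∙ ν x)ᗮ.subtypeL)).toLinearMap

/-- The Gaussian curvature at `x` of the hypersurface `S` with unit normal field `ν`: the
determinant of the shape operator. -/
noncomputable def gaussianCurvature {n : ℕ} (S : Set (E n)) (ν : E n → E n) (x : E n) : ℝ :=
  LinearMap.det (shapeOperator S ν x)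

/-- A mollifying kernel: smooth, nonnegative, zero outside the open unit ball, of integral one. -/
structure IsMollifier {n : ℕ} (χ : E n → ℝ) : Prop where
  smooth : ContDiff ℝ ∞ χ
  nonneg : ∀ x, 0 ≤ χ x
  eq_zero : ∀ x, x ∉ Metric.ball (0 : E n) 1 → χ x = 0
  integral_eq_one : ∫ x, χ x = 1

/-- The mollification of `f` at scale `1 / s`, that is, the convolution of `f` with
`y ↦ s ^ (n + 1) * χ (s y)`, a kernel of integral one supported in the ball of radius `1 / s`. -/
noncomputable def mollify {n : ℕ} (χ : E n → ℝ) (f : E n → ℝ) (s : ℝ) (x : E n) : ℝ :=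
  ∫ y, f (x - y) * (s ^ (n + 1) * χ (s • y))

end ConvexIntersection

open ConvexIntersection

/-! The determinant enters only through weighted traces. By the inequality of the means, a diagonal
form with entries μ_j ≥ 0 has determinant at least g ^ n exactly when ∑ β_j μ_j ≥ n g for all
positive weights β of product one. This condition is linear in the form, so it survives sums and
averages; it plays the role of the concavity of det ^ (1 / n).

Let g ^ n = k. Near a boundary point of curvature at least k, Taylor's formula puts each K_i below a
quadric: if m is a unit normal at p, then ⟨m, y - p⟩ + H (y - p) / 2 ≤ 0 for y ∈ K_i near p, where H
satisfies the trace condition with g slightly decreased (`exists_local_quadric`). At an edge of K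
every normal ν is a sum m₁ + m₂ of normals of K₁ and K₂ (`exists_normal_add`). Adding the two
inequalities puts K below a quadric with form ‖m₁‖ H₁ + ‖m₂‖ H₂, and since ‖m₁‖ + ‖m₂‖ ≥ ‖ν‖ = 1 the
trace condition is kept (`HasQuadrics.inter`).

The quadric at the nearest point p of z bounds the second differences of the distance d at z from
below, in directions almost orthogonal to z - p (`IsNearest.quadratic_le`,
`trace_second_difference`). The function d need not be twice differentiable, but a bound for a
weighted trace of finite differences, with fixed frame and weights, can be integrated against the
kernel and then becomes a bound for the Hessian of d_s. This requires that a frame tangent to {d_s =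
r} at x be almost tangential for d at all points within 1 / s of x, which holds because z - p is a
Lipschitz function of z (`inner_nearest_le_of_fderiv_nonpos`). Finally ‖∇d_s‖ ≤ 1, so passing from
the Hessian to the curvature loses nothing (`pow_le_gaussianCurvature_level`). -/

open Filter Topology

/-! ### Quadratic forms, determinants and weighted traces -/

/-- `H` behaves like a quadratic form with values between `c ‖v‖ ^ 2` and `M ‖v‖ ^ 2`, whose
restriction to every `n`-dimensional subspace has determinant at least `g ^ n`. -/
structure IsFormBetween {V : Type*} [NormedAddCommGroup V] [InnerProductSpace ℝ V]
    (n : ℕ) (g c M : ℝ) (H : V → ℝ) : Prop where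
  map_smul : ∀ (t : ℝ) (v : V), H (t • v) = t ^ 2 * H v
  -- Stands in for bilinearity: `H` at two nearby vectors can be compared at the cost of a factor
  -- close to one.
  add_le : ∀ (η : ℝ), 0 < η → ∀ u v : V, H (u + v) ≤ (1 + η) * H u + (1 + η⁻¹) * H v
  lower : ∀ v : V, c * ‖v‖ ^ 2 ≤ H v
  upper : ∀ v : V, H v ≤ M * ‖v‖ ^ 2
  -- For positive values `H (e j)`, the infimum over `β` is `n` times their geometric mean; by
  -- Hadamard's inequality the frames that diagonalize the restriction of a positive definite form
  -- make it smallest.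
  trace_le : ∀ e : Fin n → V, Orthonormal ℝ e → ∀ β : Fin n → ℝ, (∀ j, 0 < β j) →
    ∑ j, Real.log (β j) = 0 → n * g ≤ ∑ j, β j * H (e j)

/-- A logarithmic form of the inequality between the arithmetic and the geometric mean. -/
lemma le_sum_of_le_sum_log {n : ℕ} {g : ℝ} (hg : 0 < g) (x : Fin n → ℝ) (hx : ∀ j, 0 < x j)
    (h : n * Real.log g ≤ ∑ j, Real.log (x j)) : n * g ≤ ∑ j, x j := by
  have h1 : ∀ j, Real.log (x j) ≤ x j / g - 1 + Real.log g := fun j => by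
    have := Real.log_le_sub_one_of_pos (div_pos (hx j) hg)
    rw [Real.log_div (hx j).ne' hg.ne'] at this
    linarith
  have h2 := Finset.sum_le_sum fun j (_ : j ∈ Finset.univ) => h1 j
  simp only [Finset.sum_add_distrib, Finset.sum_sub_distrib, ← Finset.sum_div, Finset.sum_const,
    Finset.card_univ, Fintype.card_fin, nsmul_eq_mul, mul_one] at h2
  have h3 : (n : ℝ) ≤ (∑ j, x j) / g := by linarith
  rwa [le_div_iff₀ hg] at h3

namespace IsFormBetween

variable {V : Type*} [NormedAddCommGroup V] [InnerProductSpace ℝ V]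
variable {n : ℕ} {g c M : ℝ} {H : V → ℝ}

lemma mono (h : IsFormBetween n g c M H) {c' M' : ℝ} (hc : c' ≤ c) (hM : M ≤ M') :
    IsFormBetween n g c' M' H where
  map_smul := h.map_smul
  add_le := h.add_le
  lower v := (mul_le_mul_of_nonneg_right hc (sq_nonneg _)).trans (h.lower v)
  upper v := (h.upper v).trans (mul_le_mul_of_nonneg_right hM (sq_nonneg _))
  trace_le := h.trace_le

lemma const_mul (h : IsFormBetween n g c M H) {θ : ℝ} (hθ : 0 ≤ θ) :
    IsFormBetween n (θ * g) (θ * c) (θ * M) (fun v => θ * H v) where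
  map_smul t v := by rw [h.map_smul]; ring
  add_le η hη u v := by
    have := mul_le_mul_of_nonneg_left (h.add_le η hη u v) hθ
    linarith
  lower v := by rw [mul_assoc]; exact mul_le_mul_of_nonneg_left (h.lower v) hθ
  upper v := by rw [mul_assoc]; exact mul_le_mul_of_nonneg_left (h.upper v) hθ
  trace_le e he β hβ hs := by
    have := mul_le_mul_of_nonneg_left (h.trace_le e he β hβ hs) hθ
    rw [Finset.mul_sum] at this
    calc n * (θ * g) = θ * (n * g) := by ring
      _ ≤ _ := this
      _ = _ := Finset.sum_congr rfl fun j _ => by ring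

/-- The lower bound and the trace bound are multiplied by `a + b ≥ 1`, so they are not weakened;
only the upper bound pays, through `R`. -/
lemma combination {H' : V → ℝ} (h : IsFormBetween n g c M H) (h' : IsFormBetween n g c M H')
    (hg : 0 ≤ g) (hc : 0 ≤ c) (hM : 0 ≤ M) {a b R : ℝ} (ha : 0 ≤ a) (hb : 0 ≤ b)
    (hab : 1 ≤ a + b) (hR : a + b ≤ R) :
    IsFormBetween n g c (R * M) (fun v => a * H v + b * H' v) where
  map_smul t v := by rw [h.map_smul, h'.map_smul]; ring
  add_le η hη u v := by
    have h1 := mul_le_mul_of_nonneg_left (h.add_le η hη u v) ha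
    have h2 := mul_le_mul_of_nonneg_left (h'.add_le η hη u v) hb
    linarith
  lower v := by
    have h1 := mul_le_mul_of_nonneg_left (h.lower v) ha
    have h2 := mul_le_mul_of_nonneg_left (h'.lower v) hb
    have h3 := mul_le_mul_of_nonneg_right hab (mul_nonneg hc (sq_nonneg ‖v‖))
    linarith
  upper v := by
    have h1 := mul_le_mul_of_nonneg_left (h.upper v) ha
    have h2 := mul_le_mul_of_nonneg_left (h'.upper v) hb
    have h3 := mul_le_mul_of_nonneg_right hR (mul_nonneg hM (sq_nonneg ‖v‖))
    linarith
  trace_le e he β hβ hs := by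
    have h1 := mul_le_mul_of_nonneg_left (h.trace_le e he β hβ hs) ha
    have h2 := mul_le_mul_of_nonneg_left (h'.trace_le e he β hβ hs) hb
    have h3 := mul_le_mul_of_nonneg_right hab (mul_nonneg (Nat.cast_nonneg n) hg)
    have h4 : ∑ j, β j * (a * H (e j) + b * H' (e j)) =
        a * ∑ j, β j * H (e j) + b * ∑ j, β j * H' (e j) := by
      rw [Finset.mul_sum, Finset.mul_sum, ← Finset.sum_add_distrib]
      exact Finset.sum_congr rfl fun j _ => by ring
    rw [h4]
    linarith

end IsFormBetween

section

variable {V : Type*} [NormedAddCommGroup V] [InnerProductSpace ℝ V]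

lemma add_sq_le_weighted {η : ℝ} (hη : 0 < η) (a b : ℝ) :
    (a + b) ^ 2 ≤ (1 + η) * a ^ 2 + (1 + η⁻¹) * b ^ 2 := by
  have h : 0 ≤ (η * a - b) ^ 2 / η := by positivity
  have h2 : (η * a - b) ^ 2 / η = η * a ^ 2 - 2 * a * b + η⁻¹ * b ^ 2 := by
    field_simp
    ring
  nlinarith

lemma isFormBetween_norm_sq {n : ℕ} {g c M : ℝ} (hg : 0 < g) (hc : c ≤ g) (hM : g ≤ M) :
    IsFormBetween n g c M (fun v : V => g * ‖v‖ ^ 2) where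
  map_smul t v := by rw [norm_smul, mul_pow, Real.norm_eq_abs, sq_abs]; ring
  add_le η hη u v := by
    have h1 : ‖u + v‖ ^ 2 ≤ (1 + η) * ‖u‖ ^ 2 + (1 + η⁻¹) * ‖v‖ ^ 2 :=
      (pow_le_pow_left₀ (norm_nonneg _) (norm_add_le u v) 2).trans (add_sq_le_weighted hη _ _)
    have := mul_le_mul_of_nonneg_left h1 hg.le
    linarith
  lower v := mul_le_mul_of_nonneg_right hc (sq_nonneg _)
  upper v := mul_le_mul_of_nonneg_right hM (sq_nonneg _)
  trace_le e he β hβ hs := by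
    refine le_sum_of_le_sum_log hg _ (fun j => ?_) ?_
    · rw [he.1 j]
      have := hβ j
      positivity
    · have : ∀ j, Real.log (β j * (g * ‖e j‖ ^ 2)) = Real.log (β j) + Real.log g := fun j => by
        rw [he.1 j, one_pow, mul_one, Real.log_mul (hβ j).ne' hg.ne']
      simp [this, Finset.sum_add_distrib, hs]

/-- A diagonal quadratic form with largest coefficient `M` restricts to `n`-dimensional subspaces
with determinant at least the product of its other coefficients. -/
lemma isFormBetween_diagonal {n : ℕ} {g c M : ℝ} (hg : 0 < g) (hc : 0 < c)
    (f : Fin n → V) (N : V) (hf : Orthonormal ℝ f)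
    (hP : ∀ v : V, ∑ l, inner ℝ (f l) v ^ 2 + inner ℝ N v ^ 2 = ‖v‖ ^ 2)
    (κ : Fin n → ℝ) (hκc : ∀ l, c ≤ κ l) (hκM : ∀ l, κ l ≤ M) (hcM : c ≤ M)
    (hκ : n * Real.log g ≤ ∑ l, Real.log (κ l)) :
    IsFormBetween n g c M
      (fun v => ∑ l, κ l * inner ℝ (f l) v ^ 2 + M * inner ℝ N v ^ 2) := by
  have hlow : ∀ v : V, c * ‖v‖ ^ 2 ≤ ∑ l, κ l * inner ℝ (f l) v ^ 2 + M * inner ℝ N v ^ 2 := by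
    intro v
    rw [← hP v, mul_add, Finset.mul_sum]
    exact add_le_add (Finset.sum_le_sum fun l _ =>
      mul_le_mul_of_nonneg_right (hκc l) (sq_nonneg _))
      (mul_le_mul_of_nonneg_right hcM (sq_nonneg _))
  refine ⟨fun t v => ?_, fun η hη u v => ?_, hlow, fun v => ?_, fun e he β hβ hs => ?_⟩
  · simp only [inner_smul_right, mul_pow, mul_add, Finset.mul_sum]
    congr 1
    · exact Finset.sum_congr rfl fun l _ => by ring
    · ring
  · have h1 : ∀ l, κ l * inner ℝ (f l) (u + v) ^ 2 ≤
        (1 + η) * (κ l * inner ℝ (f l) u ^ 2) + (1 + η⁻¹) * (κ l * inner ℝ (f l) v ^ 2) := by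
      intro l
      have := mul_le_mul_of_nonneg_left (add_sq_le_weighted hη (inner ℝ (f l) u) (inner ℝ (f l) v))
        (hc.le.trans (hκc l))
      rw [inner_add_right]
      linarith
    have h2 := Finset.sum_le_sum fun l (_ : l ∈ Finset.univ) => h1 l
    rw [Finset.sum_add_distrib, ← Finset.mul_sum, ← Finset.mul_sum] at h2
    have h3 := mul_le_mul_of_nonneg_left (add_sq_le_weighted hη (inner ℝ N u) (inner ℝ N v))
      (hc.le.trans hcM)
    rw [inner_add_right]
    linarith
  · rw [← hP v, mul_add, Finset.mul_sum]
    exact add_le_add (Finset.sum_le_sum fun l _ =>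
      mul_le_mul_of_nonneg_right (hκM l) (sq_nonneg _)) le_rfl
  · set H : V → ℝ := fun v => ∑ l, κ l * inner ℝ (f l) v ^ 2 + M * inner ℝ N v ^ 2 with hH
    have hHpos : ∀ j, 0 < H (e j) := fun j => by
      have := hlow (e j)
      rw [he.1 j] at this
      simp only [hH]
      linarith
    have hM : 0 < M := hc.trans_le hcM
    have hκ0 : ∀ l, 0 < κ l := fun l => hc.trans_le (hκc l)
    have key : ∀ x y : ℝ, 0 < x → 0 < y → Real.log y ≤ y / x - 1 + Real.log x := by
      intro x y hx hy
      have := Real.log_le_sub_one_of_pos (div_pos hy hx)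
      rw [Real.log_div hy.ne' hx.ne'] at this
      linarith
    -- Concavity of the logarithm: the squared coordinates of the unit vector `e j` are weights of
    -- total one.
    have h1 : ∀ j, ∑ l, inner ℝ (f l) (e j) ^ 2 * Real.log (κ l)
        + inner ℝ N (e j) ^ 2 * Real.log M ≤ Real.log (H (e j)) := by
      intro j
      have ha : ∀ l, inner ℝ (f l) (e j) ^ 2 * Real.log (κ l) ≤
          (κ l * inner ℝ (f l) (e j) ^ 2) / H (e j)
            + inner ℝ (f l) (e j) ^ 2 * (Real.log (H (e j)) - 1) := fun l => by
        have := mul_le_mul_of_nonneg_left (key _ _ (hHpos j) (hκ0 l))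
          (sq_nonneg (inner ℝ (f l) (e j)))
        calc _ ≤ _ := this
          _ = _ := by ring
      have hb := mul_le_mul_of_nonneg_left (key _ _ (hHpos j) hM)
          (sq_nonneg (inner ℝ N (e j)))
      have hs := Finset.sum_le_sum fun l (_ : l ∈ Finset.univ) => ha l
      rw [Finset.sum_add_distrib, ← Finset.sum_div, ← Finset.sum_mul] at hs
      have hone := hP (e j)
      rw [he.1 j, one_pow] at hone
      have hHj : (∑ l, κ l * inner ℝ (f l) (e j) ^ 2) / H (e j)
          + M * inner ℝ N (e j) ^ 2 / H (e j) = 1 := by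
        rw [← add_div]
        exact div_self (hHpos j).ne'
      have hN : inner ℝ N (e j) ^ 2 = 1 - ∑ l, inner ℝ (f l) (e j) ^ 2 := by linarith
      have hb' : inner ℝ N (e j) ^ 2 * Real.log M ≤ M * inner ℝ N (e j) ^ 2 / H (e j)
          + inner ℝ N (e j) ^ 2 * (Real.log (H (e j)) - 1) := by
        calc _ ≤ _ := hb
          _ = _ := by ring
      have : (∑ l, inner ℝ (f l) (e j) ^ 2) * (Real.log (H (e j)) - 1)
          + inner ℝ N (e j) ^ 2 * (Real.log (H (e j)) - 1) = Real.log (H (e j)) - 1 := by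
        rw [← add_mul, hone, one_mul]
      linarith
    -- Summed over the frame, the weight of `κ l` is at most one by Bessel's inequality. The missing
    -- weight is carried by `N`, whose coefficient `M` is at least `κ l`; this is why the normal
    -- coefficient must be the largest.
    have h2 : ∑ l, Real.log (κ l) ≤ ∑ j, Real.log (H (e j)) := by
      refine le_trans ?_ (Finset.sum_le_sum fun j (_ : j ∈ Finset.univ) => h1 j)
      have hN : ∀ j, inner ℝ N (e j) ^ 2 = 1 - ∑ l, inner ℝ (f l) (e j) ^ 2 := fun j => by
        have := hP (e j)
        rw [he.1 j, one_pow] at this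
        linarith
      have hcol : ∀ l, ∑ j, inner ℝ (f l) (e j) ^ 2 ≤ 1 := fun l => by
        have := he.sum_inner_products_le (f l) (s := Finset.univ)
        rw [hf.1 l, one_pow] at this
        refine le_trans (le_of_eq (Finset.sum_congr rfl fun j _ => ?_)) this
        rw [Real.norm_eq_abs, sq_abs, real_inner_comm]
      have hl : ∀ l, Real.log (κ l) ≤ (∑ j, inner ℝ (f l) (e j) ^ 2) * Real.log (κ l)
          + (1 - ∑ j, inner ℝ (f l) (e j) ^ 2) * Real.log M := fun l => by
        have h3 := mul_le_mul_of_nonneg_left (Real.log_le_log (hκ0 l) (hκM l))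
          (sub_nonneg.2 (hcol l))
        linarith
      refine (Finset.sum_le_sum fun l (_ : l ∈ Finset.univ) => hl l).trans (le_of_eq ?_)
      simp only [hN, Finset.sum_add_distrib, ← Finset.sum_mul, Finset.sum_sub_distrib,
        Finset.sum_const, Finset.card_univ, Fintype.card_fin]
      rw [Finset.sum_comm (f := fun j l => inner ℝ (f l) (e j) ^ 2 * Real.log (κ l)),
        Finset.sum_comm (f := fun j l => inner ℝ (f l) (e j) ^ 2)]
      simp only [Finset.sum_mul]
    refine le_sum_of_le_sum_log hg _ (fun j => mul_pos (hβ j) (hHpos j)) ?_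
    have h4 : ∀ j, Real.log (β j * H (e j)) = Real.log (β j) + Real.log (H (e j)) := fun j =>
      Real.log_mul (hβ j).ne' (hHpos j).ne'
    have h5 : ∑ j, Real.log (β j * H (e j)) = ∑ j, Real.log (H (e j)) := by
      rw [Finset.sum_congr rfl fun j _ => h4 j, Finset.sum_add_distrib, hs, zero_add]
    exact (hκ.trans h2).trans h5.ge

end

/-- If the weighted traces of a nonnegative diagonal matrix are all at least `n * g`, its
determinant is at least `g ^ n`. -/
lemma pow_le_prod_of_trace_le {n : ℕ} (hn : 1 ≤ n) {g : ℝ} (hg : 0 ≤ g) (μ : Fin n → ℝ)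
    (hμ : ∀ j, 0 ≤ μ j)
    (h : ∀ β : Fin n → ℝ, (∀ j, 0 < β j) → ∑ j, Real.log (β j) = 0 → n * g ≤ ∑ j, β j * μ j) :
    g ^ n ≤ ∏ j, μ j := by
  have hn0 : (0 : ℝ) < n := by exact_mod_cast hn
  -- Some `μ j` may vanish; the shift by `t` keeps the optimal weights finite and is removed in the
  -- limit.
  have main : ∀ t : ℝ, 0 < t → g ^ n ≤ ∏ j, (μ j + t) := by
    intro t ht
    have hpos : ∀ j, 0 < μ j + t := fun j => add_pos_of_nonneg_of_pos (hμ j) ht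
    -- `Real.exp L` is the geometric mean of the `μ j + t`; dividing it by each of them gives the
    -- weights of the equality case.
    set L := (∑ j, Real.log (μ j + t)) / n with hL
    have h1 := h (fun j => Real.exp L / (μ j + t)) (fun j => div_pos (Real.exp_pos _) (hpos j)) (by
      simp only [Real.log_div (Real.exp_pos L).ne' (hpos _).ne', Real.log_exp,
        Finset.sum_sub_distrib, Finset.sum_const, Finset.card_univ, Fintype.card_fin, nsmul_eq_mul]
      rw [hL]
      field_simp
      ring)
    have h2 : ∑ j, Real.exp L / (μ j + t) * μ j ≤ ∑ _j : Fin n, Real.exp L := by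
      refine Finset.sum_le_sum fun j _ => ?_
      rw [div_mul_eq_mul_div, div_le_iff₀ (hpos j)]
      exact mul_le_mul_of_nonneg_left (by linarith) (Real.exp_pos _).le
    simp only [Finset.sum_const, Finset.card_univ, Fintype.card_fin, nsmul_eq_mul] at h2
    have h3 : g ≤ Real.exp L := le_of_mul_le_mul_left (h1.trans h2) hn0
    refine (pow_le_pow_left₀ hg h3 n).trans (le_of_eq ?_)
    rw [← Real.exp_nat_mul, hL, mul_div_cancel₀ _ hn0.ne', Real.exp_sum]
    exact Finset.prod_congr rfl fun j _ => Real.exp_log (hpos j)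
  have hcont : Filter.Tendsto (fun t : ℝ => ∏ j, (μ j + t)) (nhdsWithin 0 (Set.Ioi 0))
      (nhds (∏ j, μ j)) := by
    have : Continuous fun t : ℝ => ∏ j, (μ j + t) := by fun_prop
    have h5 := this.tendsto 0
    simp only [add_zero] at h5
    exact h5.mono_left nhdsWithin_le_nhds
  exact ge_of_tendsto hcont (Filter.eventually_of_mem self_mem_nhdsWithin main)

/-! ### Defining functions and tangent vectors -/

/-- Near `x`, the set `S` is the zero set of the `C²` function `f`, whose derivative at `x` does
not vanish. -/
structure IsLocalEquation {n : ℕ} (S : Set (E n)) (f : E n → ℝ) (x : E n) : Prop where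
  contDiffAt : ContDiffAt ℝ 2 f x
  fderiv_ne_zero : fderiv ℝ f x ≠ 0
  mem_iff : ∀ᶠ y in 𝓝 x, y ∈ S ↔ f y = 0

/-- The second order Taylor formula, uniform in the centre of the expansion. -/
lemma ContDiffAt.uniform_taylor_two {V : Type*} [NormedAddCommGroup V] [NormedSpace ℝ V]
    {f : V → ℝ} {x : V} (hf : ContDiffAt ℝ 2 f x) {η : ℝ} (hη : 0 < η) :
    ∃ δ > 0, ∀ p w : V, ‖p - x‖ < δ → ‖p + w - x‖ < δ →
      |f (p + w) - f p - fderiv ℝ f p w - 1 / 2 * fderiv ℝ (fderiv ℝ f) x w w| ≤ η * ‖w‖ ^ 2 := by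
  set B := fderiv ℝ (fderiv ℝ f) x with hB
  have hsymm : ∀ u v, B u v = B v u := hf.isSymmSndFDerivAt (by simp)
  -- Strict differentiability compares the derivative at two moving points, so the Hessian at `x`
  -- serves for every centre `p` near `x`.
  have h1 : HasStrictFDerivAt (fderiv ℝ f) B x :=
    (hf.fderiv_right (m := 1) (by norm_num)).hasStrictFDerivAt one_ne_zero
  have h2 := h1.isLittleO.def hη
  have h3 : ∀ᶠ y in 𝓝 x, DifferentiableAt ℝ f y :=
    (hf.eventually (by simp)).mono fun y hy => hy.differentiableAt two_ne_zero
  obtain ⟨δ₁, hδ₁, H1⟩ := Metric.eventually_nhds_iff.1 h2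
  obtain ⟨δ₂, hδ₂, H2⟩ := Metric.eventually_nhds_iff.1 h3
  refine ⟨min δ₁ δ₂, lt_min hδ₁ hδ₂, fun p w hp hw => ?_⟩
  have hball : ∀ y ∈ segment ℝ (0 : V) w, ‖p + y - x‖ < min δ₁ δ₂ := by
    intro y hy
    have hc : Convex ℝ (Metric.ball x (min δ₁ δ₂)) := convex_ball _ _
    have hp' : p ∈ Metric.ball x (min δ₁ δ₂) := by rwa [mem_ball_iff_norm]
    have hw' : p + w ∈ Metric.ball x (min δ₁ δ₂) := by rwa [mem_ball_iff_norm]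
    obtain ⟨θ, hθ, rfl⟩ := (segment_eq_image' ℝ (0 : V) w) ▸ hy
    have := hc.add_smul_sub_mem hp' hw' hθ
    rw [mem_ball_iff_norm] at this
    simpa using this
  have hderiv : ∀ y ∈ segment ℝ (0 : V) w, HasFDerivWithinAt
      (fun y => f (p + y) - fderiv ℝ f p y - 1 / 2 * B y y)
      (fderiv ℝ f (p + y) - fderiv ℝ f p - B y) (segment ℝ 0 w) y := by
    intro y hy
    have hd : DifferentiableAt ℝ f (p + y) :=
      H2 (by rw [dist_eq_norm]; exact (hball y hy).trans_le (min_le_right _ _))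
    have ha : HasFDerivAt (fun y => f (p + y)) (fderiv ℝ f (p + y)) y :=
      (hasFDerivAt_comp_add_left p).2 hd.hasFDerivAt
    have hb : HasFDerivAt (fun y => B y y) (B y + B.flip y) y := by
      have := (B.hasFDerivAt (x := y)).clm_apply (hasFDerivAt_id y)
      convert! this using 1
    have hc := (ha.sub (fderiv ℝ f p).hasFDerivAt).sub (hb.const_mul (1 / 2))
    refine (hc.congr_fderiv ?_).hasFDerivWithinAt
    ext v
    simp [hsymm v y]
    ring
  have hbound : ∀ y ∈ segment ℝ (0 : V) w, ‖fderiv ℝ f (p + y) - fderiv ℝ f p - B y‖ ≤ η * ‖w‖ := by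
    intro y hy
    have hy1 : Dist.dist (p + y, p) (x, x) < δ₁ := by
      rw [Prod.dist_eq, max_lt_iff, dist_eq_norm, dist_eq_norm]
      exact ⟨(hball y hy).trans_le (min_le_left _ _), hp.trans_le (min_le_left _ _)⟩
    have := H1 hy1
    simp only [add_sub_cancel_left] at this
    refine this.trans (mul_le_mul_of_nonneg_left ?_ hη.le)
    obtain ⟨θ, hθ, rfl⟩ := (segment_eq_image' ℝ (0 : V) w) ▸ hy
    simp only [sub_zero, zero_add, norm_smul, Real.norm_eq_abs, abs_of_nonneg hθ.1]
    exact mul_le_of_le_one_left (norm_nonneg _) hθ.2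
  have := (convex_segment (0 : V) w).norm_image_sub_le_of_norm_hasFDerivWithin_le hderiv hbound
    (left_mem_segment ℝ 0 w) (right_mem_segment ℝ 0 w)
  simp only [sub_zero, add_zero, map_zero, mul_zero, Real.norm_eq_abs] at this
  calc _ = _ := by congr 1; ring
    _ ≤ _ := this
    _ = _ := by ring

namespace IsLocalEquation

variable {n : ℕ} {S : Set (E n)} {f : E n → ℝ} {x : E n}

lemma eventually (h : IsLocalEquation S f x) : ∀ᶠ y in 𝓝 x, IsLocalEquation S f y := by
  have h1 : ContinuousAt (fderiv ℝ f) x :=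
    (h.contDiffAt.fderiv_right (m := 1) (by norm_num)).continuousAt
  filter_upwards [h.contDiffAt.eventually (by simp), h1.eventually_ne h.fderiv_ne_zero,
    h.mem_iff.eventually_nhds] with y h1 h2 h3 using ⟨h1, h2, h3⟩

lemma neg (h : IsLocalEquation S f x) : IsLocalEquation S (-f) x where
  contDiffAt := h.contDiffAt.neg
  fderiv_ne_zero := by rw [fderiv_neg]; exact neg_ne_zero.2 h.fderiv_ne_zero
  mem_iff := h.mem_iff.mono fun y hy => by simp [hy]

lemma gradient_ne_zero (h : IsLocalEquation S f x) : gradient f x ≠ 0 := by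
  simpa [gradient] using h.fderiv_ne_zero

lemma fderiv_apply (f : E n → ℝ) (x v : E n) : fderiv ℝ f x v = inner ℝ (gradient f x) v := by
  rw [← toDual_gradient, InnerProductSpace.toDual_apply_apply]

/-- Vectors annihilated by the derivative of a defining function are tangent vectors. -/
lemma exists_near_mem (h : IsLocalEquation S f x) (hx : x ∈ S) {v : E n}
    (hv : fderiv ℝ f x v = 0) {ε : ℝ} (hε : 0 < ε) :
    ∀ᶠ t in 𝓝[>] (0 : ℝ), ∃ w : E n, ‖w - v‖ ≤ ε ∧ x + t • w ∈ S := by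
  set G := gradient f x with hG
  have hG0 : 0 < ‖G‖ := norm_pos_iff.2 h.gradient_ne_zero
  set u : E n := ‖G‖⁻¹ • G with hu
  have hu1 : ‖u‖ = 1 := norm_smul_inv_norm h.gradient_ne_zero
  have hfu : fderiv ℝ f x u = ‖G‖ := by
    rw [fderiv_apply, hu, inner_smul_right, ← hG, real_inner_self_eq_norm_sq]
    field_simp
  have hfx : f x = 0 := h.mem_iff.self_of_nhds.1 hx
  -- With this constant the linearization error is at most half of `t * ε * ‖G‖`, the size of the
  -- linear term at `τ = ±ε`; hence `f` changes sign along the gradient direction.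
  set c := ‖G‖ * ε / (2 * (‖v‖ + ε)) with hc
  have hve : 0 < ‖v‖ + ε := by positivity
  have hc0 : 0 < c := by positivity
  have h1 := (h.contDiffAt.differentiableAt two_ne_zero).hasFDerivAt.isLittleO.def hc0
  have h2 : ∀ᶠ y in 𝓝 x, ContinuousAt f y :=
    (h.contDiffAt.eventually (by simp)).mono fun y hy => hy.continuousAt
  obtain ⟨δ, hδ, H⟩ := Metric.eventually_nhds_iff.1 (h1.and (h2.and h.mem_iff))
  have h3 : ∀ᶠ t in 𝓝[>] (0 : ℝ), t < δ / (‖v‖ + ε) :=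
    mem_nhdsWithin_of_mem_nhds (Iio_mem_nhds (by positivity))
  filter_upwards [h3, self_mem_nhdsWithin] with t ht ht0
  have ht0 : 0 < t := ht0
  have hnorm : ∀ τ ∈ Set.Icc (-ε) ε, ‖v + τ • u‖ ≤ ‖v‖ + ε := fun τ hτ => by
    refine (norm_add_le _ _).trans (add_le_add_right ?_ _)
    rw [norm_smul, hu1, mul_one, Real.norm_eq_abs]
    exact abs_le.2 hτ
  have hnear : ∀ τ ∈ Set.Icc (-ε) ε, dist (x + t • (v + τ • u)) x < δ := fun τ hτ => by
    rw [dist_eq_norm, add_sub_cancel_left, norm_smul, Real.norm_eq_abs, abs_of_pos ht0]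
    rw [lt_div_iff₀ hve] at ht
    exact (mul_le_mul_of_nonneg_left (hnorm τ hτ) ht0.le).trans_lt ht
  have hval : ∀ τ ∈ Set.Icc (-ε) ε,
      |f (x + t • (v + τ • u)) - t * (τ * ‖G‖)| ≤ t * (‖G‖ * ε / 2) := fun τ hτ => by
    have := (H (hnear τ hτ)).1
    rw [hfx, add_sub_cancel_left, map_smul, map_add, map_smul, hv, hfu, norm_smul, Real.norm_eq_abs,
      Real.norm_eq_abs, abs_of_pos ht0] at this
    simp only [sub_zero, zero_add, smul_eq_mul] at this
    refine this.trans ?_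
    calc c * (t * ‖v + τ • u‖) ≤ c * (t * (‖v‖ + ε)) := by
          gcongr
          exact hnorm τ hτ
      _ = _ := by rw [hc]; field_simp
  have hcont : ContinuousOn (fun τ : ℝ => f (x + t • (v + τ • u))) (Set.Icc (-ε) ε) := by
    intro τ hτ
    refine ContinuousAt.continuousWithinAt ?_
    refine ContinuousAt.comp (g := f) (H (hnear τ hτ)).2.1 ?_
    fun_prop
  have hpos : 0 < t * (‖G‖ * ε / 2) := by positivity
  have hl := abs_le.1 (hval (-ε) ⟨le_rfl, by linarith⟩)
  have hr := abs_le.1 (hval ε ⟨by linarith, le_rfl⟩)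
  have h0 : (0 : ℝ) ∈ Set.Icc (f (x + t • (v + (-ε) • u))) (f (x + t • (v + ε • u))) :=
    ⟨by nlinarith [hl.2], by nlinarith [hr.1]⟩
  obtain ⟨τ, hτ, hτ0⟩ := intermediate_value_Icc (by linarith : -ε ≤ ε) hcont h0
  refine ⟨v + τ • u, ?_, (H (hnear τ hτ)).2.2.2 hτ0⟩
  rw [add_sub_cancel_left, norm_smul, hu1, mul_one, Real.norm_eq_abs]
  exact abs_le.2 hτ

lemma mem_tangentConeAt (h : IsLocalEquation S f x) (hx : x ∈ S) {v : E n}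
    (hv : fderiv ℝ f x v = 0) : v ∈ tangentConeAt ℝ S x := by
  have h1 : ∀ k : ℕ, ∃ (t : ℝ) (w : E n), 0 < t ∧ t < 1 / ((k : ℝ) + 1) ∧
      ‖w - v‖ ≤ 1 / ((k : ℝ) + 1) ∧ x + t • w ∈ S := fun k => by
    have hk : (0 : ℝ) < 1 / ((k : ℝ) + 1) := Nat.one_div_pos_of_nat
    have h2 : ∀ᶠ t in 𝓝[>] (0 : ℝ), t < 1 / ((k : ℝ) + 1) :=
      mem_nhdsWithin_of_mem_nhds (Iio_mem_nhds hk)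
    obtain ⟨t, ⟨w, hw, hw'⟩, ht, ht0⟩ :=
      ((h.exists_near_mem hx hv hk).and (h2.and self_mem_nhdsWithin)).exists
    exact ⟨t, w, ht0, ht, hw, hw'⟩
  choose t w ht0 ht hw hS using h1
  have hlim := tendsto_one_div_add_atTop_nhds_zero_nat (𝕜 := ℝ)
  have hwlim : Tendsto w atTop (𝓝 v) :=
    tendsto_iff_norm_sub_tendsto_zero.2 (squeeze_zero (fun _ => norm_nonneg _) hw hlim)
  have htlim : Tendsto t atTop (𝓝 0) :=
    squeeze_zero (fun k => (ht0 k).le) (fun k => (ht k).le) hlim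
  refine mem_tangentConeAt_of_seq atTop (fun k => (t k)⁻¹) (fun k => t k • w k) ?_
    (Eventually.of_forall hS) ?_
  · simpa using htlim.smul hwlim
  · refine hwlim.congr fun k => ?_
    rw [smul_smul, inv_mul_cancel₀ (ht0 k).ne', one_smul]

/-- A tangent vector is a limit of rescaled chords of `S`, for which the inequality is assumed. -/
lemma inner_nonpos_of_support (h : IsLocalEquation S f x) (hx : x ∈ S) {m : E n}
    (hm : ∀ y ∈ S, inner ℝ m (y - x) ≤ 0) {v : E n} (hv : fderiv ℝ f x v = 0) :
    inner ℝ m v ≤ 0 := by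
  refine le_of_forall_pos_le_add fun ε hε => ?_
  have hε' : 0 < ε / (‖m‖ + 1) := by positivity
  obtain ⟨t, ⟨w, hw, hw'⟩, ht⟩ := ((h.exists_near_mem hx hv hε').and self_mem_nhdsWithin).exists
  have ht : 0 < t := ht
  have h1 := hm _ hw'
  rw [add_sub_cancel_left, inner_smul_right] at h1
  have h2 : inner ℝ m w ≤ 0 := nonpos_of_mul_nonpos_right h1 ht
  have h3 : inner ℝ m (v - w) ≤ ‖m‖ * ‖v - w‖ := real_inner_le_norm _ _
  rw [inner_sub_right, norm_sub_rev] at h3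
  have h4 : ‖m‖ * ‖w - v‖ ≤ ε := by
    rw [le_div_iff₀ (by positivity)] at hw
    nlinarith [norm_nonneg (w - v)]
  linarith

/-- A normal vector of a set bounded by `S` is a multiple of the gradient of a defining
function. -/
lemma eq_smul_gradient_of_support (h : IsLocalEquation S f x) (hx : x ∈ S) {m : E n}
    (hm : ∀ y ∈ S, inner ℝ m (y - x) ≤ 0) :
    m = (inner ℝ m (gradient f x) / ‖gradient f x‖ ^ 2) • gradient f x := by
  set G := gradient f x with hG
  have hG0 : ‖G‖ ≠ 0 := norm_ne_zero_iff.2 h.gradient_ne_zero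
  -- The tangential part of `m` is itself tangent, so `‖v‖ ^ 2 = inner ℝ m v ≤ 0`.
  set v := m - (inner ℝ m G / ‖G‖ ^ 2) • G with hv
  have hv0 : inner ℝ G v = 0 := by
    rw [hv, inner_sub_right, inner_smul_right, real_inner_self_eq_norm_sq, real_inner_comm]
    field_simp
    ring
  have hfv : fderiv ℝ f x v = 0 := by rw [fderiv_apply, hv0]
  have h1 := h.inner_nonpos_of_support hx hm hfv
  have h2 : inner ℝ v v = inner ℝ m v := by
    nth_rewrite 1 [hv]
    rw [inner_sub_left, real_inner_smul_left, hv0]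
    simp
  rw [real_inner_self_eq_norm_sq] at h2
  have h3 : v = 0 := by
    rw [← norm_eq_zero]
    nlinarith [norm_nonneg v]
  exact sub_eq_zero.1 h3

end IsLocalEquation

/-! ### Convex bodies near smooth boundary points -/

section convex

variable {n : ℕ} {K : Set (E n)} {f : E n → ℝ} {x q : E n}

lemma inner_lt_zero_of_mem_interior {m p : E n} (hm0 : m ≠ 0)
    (hm : ∀ y ∈ K, inner ℝ m (y - p) ≤ 0) (hq : q ∈ interior K) : inner ℝ m (q - p) < 0 := by
  have h1 : Tendsto (fun t : ℝ => q + t • m) (𝓝[>] 0) (𝓝 q) := by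
    have : Continuous fun t : ℝ => q + t • m := by fun_prop
    have h2 := this.tendsto 0
    simp only [zero_smul, add_zero] at h2
    exact h2.mono_left nhdsWithin_le_nhds
  obtain ⟨t, ht, ht0⟩ :=
    ((h1.eventually (mem_interior_iff_mem_nhds.1 hq)).and self_mem_nhdsWithin).exists
  have ht0 : 0 < t := ht0
  have h3 := hm _ ht
  have h4 : q + t • m - p = (q - p) + t • m := by abel
  rw [h4, inner_add_right, inner_smul_right, real_inner_self_eq_norm_sq] at h3
  have : 0 < t * ‖m‖ ^ 2 := by
    have := norm_pos_iff.2 hm0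
    positivity
  linarith

lemma exists_supporting_vector (hK : Convex ℝ K) (hq : q ∈ interior K) (hx : x ∈ frontier K) :
    ∃ m : E n, ‖m‖ = 1 ∧ ∀ y ∈ K, inner ℝ m (y - x) ≤ 0 := by
  obtain ⟨φ, hφ0, hφ⟩ := geometric_hahn_banach_of_nonempty_interior_point hK hx.2 ⟨q, hq⟩
  set m := (InnerProductSpace.toDual ℝ (E n)).symm φ with hm
  have hm0 : m ≠ 0 := by simpa [hm] using hφ0
  have happ : ∀ y, inner ℝ m y = φ y := fun y => by
    rw [hm, InnerProductSpace.toDual_symm_apply]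
  refine ⟨‖m‖⁻¹ • m, norm_smul_inv_norm hm0, fun y hy => ?_⟩
  rw [real_inner_smul_left, happ, map_sub]
  exact mul_nonpos_of_nonneg_of_nonpos (by simp) (sub_nonpos.2 (hφ y hy))

lemma IsLocalEquation.fderiv_interior_ne_zero (h : IsLocalEquation (frontier K) f x)
    (hK : Convex ℝ K) (hKc : IsClosed K) (hq : q ∈ interior K) (hx : x ∈ frontier K) :
    fderiv ℝ f x (q - x) ≠ 0 := by
  obtain ⟨m, hm1, hm⟩ := exists_supporting_vector hK hq hx
  have hm0 : m ≠ 0 := norm_ne_zero_iff.1 (by rw [hm1]; exact one_ne_zero)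
  have h1 := inner_lt_zero_of_mem_interior hm0 hm hq
  rw [h.eq_smul_gradient_of_support hx fun y hy => hm y (hKc.frontier_subset hy),
    real_inner_smul_left, ← fderiv_apply] at h1
  intro h2
  simp [h2] at h1

/-- Support makes `m` a multiple of the gradient, and the decrease of `f` towards `q` fixes the
sign. No normalization is imposed, since the two components of a normal at an edge have arbitrary
length and may vanish. -/
lemma IsLocalEquation.eq_norm_smul (h : IsLocalEquation (frontier K) f x) (hKc : IsClosed K)
    (hq : q ∈ K) (hx : x ∈ frontier K) (hqx : fderiv ℝ f x (q - x) < 0) {m : E n}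
    (hm : ∀ y ∈ K, inner ℝ m (y - x) ≤ 0) :
    m = ‖m‖ • (‖gradient f x‖⁻¹ • gradient f x) := by
  have h1 := h.eq_smul_gradient_of_support hx fun y hy => hm y (hKc.frontier_subset hy)
  set a := inner ℝ m (gradient f x) / ‖gradient f x‖ ^ 2
  have hG0 : ‖gradient f x‖ ≠ 0 := norm_ne_zero_iff.2 h.gradient_ne_zero
  have h2 := hm q hq
  rw [h1, real_inner_smul_left, ← fderiv_apply] at h2
  have ha : 0 ≤ a := by
    by_contra ha
    have : 0 < a * fderiv ℝ f x (q - x) := mul_pos_of_neg_of_neg (not_le.1 ha) hqx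
    linarith
  have h3 : ‖m‖ = a * ‖gradient f x‖ := by
    rw [h1, norm_smul, Real.norm_eq_abs, abs_of_nonneg ha]
  rw [h3, smul_smul, mul_assoc, mul_inv_cancel₀ hG0, mul_one]
  exact h1

/-- The outward normal of a convex body is the normalized gradient of a defining function that
decreases inwards. -/
lemma IsLocalEquation.outwardNormal_eq (h : IsLocalEquation (frontier K) f x)
    (hK : Convex ℝ K) (hKc : IsClosed K) (hq : q ∈ interior K) (hx : x ∈ frontier K)
    (hqx : fderiv ℝ f x (q - x) < 0) :
    outwardNormal K x = ‖gradient f x‖⁻¹ • gradient f x := by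
  obtain ⟨m, hm1, hm⟩ := exists_supporting_vector hK hq hx
  have hex : ∃ m, IsSupportingNormal K x m := ⟨m, hm1, fun y hy => by
    rw [real_inner_comm]
    exact hm y hy⟩
  have hs : IsSupportingNormal K x (outwardNormal K x) := Classical.epsilon_spec hex
  have := h.eq_norm_smul hKc (interior_subset hq) hx hqx (m := outwardNormal K x) fun y hy => by
    rw [real_inner_comm]
    exact hs.2 y hy
  rwa [hs.1, one_smul] at this

/-- A defining function can be chosen to decrease inwards. -/
lemma exists_isLocalEquation_neg {x : E n} (hS : IsSmoothHypersurfaceNear (frontier K) x)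
    (hK : Convex ℝ K) (hKc : IsClosed K) (hq : q ∈ interior K) (hx : x ∈ frontier K) :
    ∃ f : E n → ℝ, IsLocalEquation (frontier K) f x ∧ fderiv ℝ f x (q - x) < 0 := by
  obtain ⟨V, hV, hxV, f, hf, hf0, hSV⟩ := hS
  have h : IsLocalEquation (frontier K) f x := by
    refine ⟨((hf x hxV).contDiffAt (hV.mem_nhds hxV)).of_le
      (WithTop.coe_le_coe.2 (le_top : (2 : ℕ∞) ≤ ⊤)),
      hf0 x hxV, ?_⟩
    filter_upwards [hV.mem_nhds hxV] with y hy
    have := Set.ext_iff.1 hSV y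
    simpa [hy] using this
  rcases lt_or_gt_of_ne (h.fderiv_interior_ne_zero hK hKc hq hx) with h1 | h1
  · exact ⟨f, h, h1⟩
  · exact ⟨-f, h.neg, by rw [fderiv_neg]; simpa using h1⟩

lemma IsLocalEquation.eventually_fderiv_neg {S : Set (E n)} (h : IsLocalEquation S f x)
    (hqx : fderiv ℝ f x (q - x) < 0) : ∀ᶠ y in 𝓝 x, fderiv ℝ f y (q - y) < 0 := by
  have h1 : ContinuousAt (fderiv ℝ f) x :=
    (h.contDiffAt.fderiv_right (m := 1) (by norm_num)).continuousAt
  have h2 : ContinuousAt (fun y => fderiv ℝ f y (q - y)) x :=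
    h1.clm_apply (by fun_prop)
  exact h2.eventually_lt_const hqx

/-- Near a smooth boundary point, a convex body is a sublevel set of a defining function. -/
lemma IsLocalEquation.eventually_mem_iff (h : IsLocalEquation (frontier K) f x)
    (hK : Convex ℝ K) (hKc : IsClosed K) (hq : q ∈ interior K) (hx : x ∈ frontier K)
    (hqx : fderiv ℝ f x (q - x) < 0) : ∀ᶠ y in 𝓝 x, y ∈ K ↔ f y ≤ 0 := by
  set c := -fderiv ℝ f x (q - x) with hc
  have hc0 : 0 < c := by rw [hc]; linarith
  set D := ‖q - x‖ + 1 with hD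
  have hD0 : 0 < D := by positivity
  have h1 := (h.contDiffAt.hasStrictFDerivAt two_ne_zero).isLittleO.def
    (show (0 : ℝ) < c / (4 * D) by positivity)
  have h2 : ∀ᶠ y in 𝓝 x, ContinuousAt f y :=
    (h.contDiffAt.eventually (by simp)).mono fun y hy => hy.continuousAt
  have hcont : ContinuousAt (fun y => fderiv ℝ f x (q - y)) x := by fun_prop
  have h3 : ∀ᶠ y in 𝓝 x, fderiv ℝ f x (q - y) < -(c / 2) :=
    hcont.eventually_lt_const (by linarith)
  have hcont' : ContinuousAt (fun y => ‖q - y‖) x := by fun_prop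
  have h4 : ∀ᶠ y in 𝓝 x, ‖q - y‖ < D := hcont'.eventually_lt_const (by linarith)
  obtain ⟨δ₁, hδ₁, H1⟩ := Metric.eventually_nhds_iff.1 h1
  obtain ⟨δ₂, hδ₂, H2⟩ := Metric.eventually_nhds_iff.1 (h2.and h.mem_iff)
  set δ := min δ₁ δ₂ with hδ
  have hδ0 : 0 < δ := lt_min hδ₁ hδ₂
  -- Steps of parameter up to `σ` remain where `f` has slope at most `-c / 4` towards `q`; since `|f
  -- y| < c / 4 * σ`, such a step reaches a zero of `f`.
  set σ := min (δ / (2 * D)) (1 / 2) with hσ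
  have hσ0 : 0 < σ := lt_min (by positivity) (by norm_num)
  have hσ1 : σ < 1 := (min_le_right _ _).trans_lt (by norm_num)
  have hfx : f x = 0 := h.mem_iff.self_of_nhds.1 hx
  have h5 : ∀ᶠ y in 𝓝 x, |f y| < c / 4 * σ := by
    have : ContinuousAt (fun y => |f y|) x := h.contDiffAt.continuousAt.abs
    refine this.eventually_lt_const ?_
    simp only [hfx, abs_zero]
    positivity
  filter_upwards [h3, h4, h5, Metric.ball_mem_nhds x (half_pos hδ0)] with y hy3 hy4 hy5 hyb
  rw [mem_ball_iff_norm] at hyb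
  have hnear : ∀ s : ℝ, |s| ≤ σ → dist (y + s • (q - y)) x < δ := fun s hs => by
    rw [dist_eq_norm, add_sub_right_comm]
    refine (norm_add_le _ _).trans_lt ?_
    have : ‖s • (q - y)‖ ≤ δ / 2 := by
      rw [norm_smul, Real.norm_eq_abs]
      calc |s| * ‖q - y‖ ≤ δ / (2 * D) * D := by
            gcongr
            exact hs.trans (min_le_left _ _)
        _ = δ / 2 := by field_simp
    linarith
  have hyd : dist y x < δ := by rw [dist_eq_norm]; linarith
  have hval : ∀ s : ℝ, |s| ≤ σ →
      |f (y + s • (q - y)) - f y - s * fderiv ℝ f x (q - y)| ≤ c / 4 * |s| := fun s hs => by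
    have h6 : dist (y + s • (q - y), y) (x, x) < δ₁ := by
      rw [Prod.dist_eq, max_lt_iff]
      exact ⟨(hnear s hs).trans_le (min_le_left _ _), hyd.trans_le (min_le_left _ _)⟩
    have := H1 h6
    simp only [add_sub_cancel_left, map_smul, smul_eq_mul, Real.norm_eq_abs, norm_smul] at this
    refine this.trans ?_
    calc c / (4 * D) * (|s| * ‖q - y‖) ≤ c / (4 * D) * (|s| * D) := by gcongr
      _ = c / 4 * |s| := by field_simp
  have hpath : Continuous fun s : ℝ => y + s • (q - y) := by fun_prop
  have hc1 : ContinuousOn (fun s : ℝ => f (y + s • (q - y))) (Set.Icc (-σ) σ) := fun s hs =>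
    (ContinuousAt.comp (f := fun s : ℝ => y + s • (q - y)) (g := f) (H2 ((hnear s (abs_le.2 hs)).trans_le (min_le_right _ _))).1
      hpath.continuousAt).continuousWithinAt
  have hy5' := abs_lt.1 hy5
  constructor
  -- If `f y > 0`, a zero of `f` occurs on the way from `y ∈ K` to `q`. It would be a frontier
  -- point, but the segment beyond `y` is interior.
  · intro hyK
    by_contra hfy
    rw [not_le] at hfy
    have hv := (abs_le.1 (hval σ (by rw [abs_of_pos hσ0]))).2
    rw [abs_of_pos hσ0] at hv
    have hneg : f (y + σ • (q - y)) ≤ 0 := by nlinarith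
    have h0 : (0 : ℝ) ∈ Set.Icc (f (y + σ • (q - y))) (f (y + (0 : ℝ) • (q - y))) :=
      ⟨hneg, by simpa using hfy.le⟩
    obtain ⟨s, hs, hs0⟩ := intermediate_value_Icc' hσ0.le
      (hc1.mono (Set.Icc_subset_Icc (by linarith) le_rfl)) h0
    have hs0' : f (y + s • (q - y)) = 0 := hs0
    have hspos : 0 < s := by
      rcases hs.1.lt_or_eq with h7 | h7
      · exact h7
      · rw [← h7, zero_smul, add_zero] at hs0'
        linarith
    have hmem : y + s • (q - y) ∈ frontier K := (H2 ((hnear s (abs_le.2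
      ⟨by linarith [hs.1], hs.2⟩)).trans_le (min_le_right _ _))).2.2 hs0'
    have hint : y + s • (q - y) ∈ interior K :=
      hK.add_smul_sub_mem_interior hyK hq ⟨hspos, hs.2.trans hσ1.le⟩
    exact hmem.2 hint
  -- Moving away from `q` one meets a frontier point, and `y` lies between it and `q`.
  · intro hfy
    have hv := (abs_le.1 (hval (-σ) (by rw [abs_neg, abs_of_pos hσ0]))).1
    rw [abs_neg, abs_of_pos hσ0] at hv
    have hpos : 0 ≤ f (y + (-σ) • (q - y)) := by nlinarith
    have h0 : (0 : ℝ) ∈ Set.Icc (f (y + (0 : ℝ) • (q - y))) (f (y + (-σ) • (q - y))) :=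
      ⟨by simpa using hfy, hpos⟩
    obtain ⟨s, hs, hs0⟩ := intermediate_value_Icc' (by linarith : -σ ≤ 0)
      (hc1.mono (Set.Icc_subset_Icc le_rfl hσ0.le)) h0
    have hmem : y + s • (q - y) ∈ frontier K := (H2 ((hnear s (abs_le.2
      ⟨hs.1, by linarith [hs.2]⟩)).trans_le (min_le_right _ _))).2.2 hs0
    have hmK := hKc.frontier_subset hmem
    have h1s : 0 < 1 - s := by linarith [hs.2]
    have h8 := hK hmK (interior_subset hq) (a := 1 / (1 - s)) (b := -s / (1 - s))
      (by positivity) (div_nonneg (by linarith [hs.2]) h1s.le) (by field_simp; ring)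
    have h9 : (1 / (1 - s)) • (y + s • (q - y)) + (-s / (1 - s)) • q = y := by
      have : (1 / (1 - s)) • (y + s • (q - y)) + (-s / (1 - s)) • q
          = ((1 - s) / (1 - s)) • y := by
        simp only [div_eq_mul_inv, one_mul]
        module
      rw [this, div_self h1s.ne', one_smul]
    rwa [h9] at h8

end convex

/-! ### Gaussian curvature in terms of a defining function -/

section curvature

variable {n : ℕ} {S : Set (E n)} {f : E n → ℝ} {x : E n} {ν : E n → E n}

lemma IsLocalEquation.exists_hasFDerivAt_gradient (h : IsLocalEquation S f x) :
    ∃ D : E n →L[ℝ] E n, HasFDerivAt (gradient f) D x ∧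
      ∀ v u, inner ℝ (D v) u = fderiv ℝ (fderiv ℝ f) x v u := by
  have h1 : HasFDerivAt (fderiv ℝ f) (fderiv ℝ (fderiv ℝ f) x) x :=
    ((h.contDiffAt.fderiv_right (m := 1) (by norm_num)).differentiableAt one_ne_zero).hasFDerivAt
  have h2 := (InnerProductSpace.toDual ℝ (E n)).symm.toContinuousLinearEquiv.hasFDerivAt.comp x h1
  refine ⟨_, h2, fun v u => ?_⟩
  simp [InnerProductSpace.toDual_symm_apply]

/-- The second fundamental form in terms of a defining function. -/
lemma inner_shapeOperator (h : IsLocalEquation S f x) (hx : x ∈ S)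
    (hν : ∀ᶠ y in 𝓝 x, y ∈ S → ν y = ‖gradient f y‖⁻¹ • gradient f y) (v u : (ℝ ∙ ν x)ᗮ) :
    inner ℝ (shapeOperator S ν x v) u =
      ‖gradient f x‖⁻¹ * fderiv ℝ (fderiv ℝ f) x v u := by
  obtain ⟨D, hD, hDB⟩ := h.exists_hasFDerivAt_gradient
  have hG0 := h.gradient_ne_zero
  have hnorm : DifferentiableAt ℝ (fun y => ‖gradient f y‖⁻¹) x :=
    (hD.differentiableAt.norm ℝ hG0).inv (norm_ne_zero_iff.2 hG0)
  have hN := hnorm.hasFDerivAt.smul hD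
  -- The derivative of the normalizing factor contributes a multiple of the gradient, which is
  -- orthogonal to tangent vectors.
  set N' := ‖gradient f x‖⁻¹ • D + (fderiv ℝ (fun y => ‖gradient f y‖⁻¹) x).smulRight (gradient f x)
  have hνx : ν x = ‖gradient f x‖⁻¹ • gradient f x := hν.self_of_nhds hx
  have hν' : HasFDerivWithinAt ν N' S x := by
    refine (hN.hasFDerivWithinAt (s := S)).congr_of_eventuallyEq ?_ hνx
    exact eventually_nhdsWithin_iff.2 hν
  have horth : ∀ w : (ℝ ∙ ν x)ᗮ, inner ℝ (gradient f x) (w : E n) = 0 := fun w => by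
    have : ‖gradient f x‖⁻¹ * inner ℝ (gradient f x) (w : E n) = 0 := by
      rw [← real_inner_smul_left, ← hνx]
      exact Submodule.mem_orthogonal_singleton_iff_inner_right.1 w.2
    exact (mul_eq_zero.1 this).resolve_left (inv_ne_zero (norm_ne_zero_iff.2 hG0))
  have htan : (v : E n) ∈ tangentConeAt ℝ S x :=
    h.mem_tangentConeAt hx (by rw [IsLocalEquation.fderiv_apply, horth])
  -- A derivative within `S` is not unique on the whole space, but any two agree on the tangent
  -- cone.
  have heq := hν'.differentiableWithinAt.hasFDerivWithinAt.unique_on hν' htan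
  have h1 : inner ℝ (shapeOperator S ν x v) u = inner ℝ (fderivWithin ℝ ν S x v) (u : E n) := by
    simp [shapeOperator]
  rw [h1, heq]
  simp only [N', add_apply, smul_apply,
    ContinuousLinearMap.smulRight_apply, inner_add_left, real_inner_smul_left, horth, mul_zero,
    add_zero, hDB]

/-- The Gaussian curvature is the product of the principal curvatures, which are the values of the
second derivative of a defining function on an orthonormal basis of principal directions. -/
lemma exists_principal_basis (h : IsLocalEquation S f x) (hx : x ∈ S)
    (hν : ∀ᶠ y in 𝓝 x, y ∈ S → ν y = ‖gradient f y‖⁻¹ • gradient f y) :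
    ∃ e : Fin n → E n, Orthonormal ℝ e ∧ (∀ j, inner ℝ (gradient f x) (e j) = 0) ∧
      gaussianCurvature S ν x =
        ∏ j, ‖gradient f x‖⁻¹ * fderiv ℝ (fderiv ℝ f) x (e j) (e j) ∧
      (∀ v, ∑ l, inner ℝ (e l) v ^ 2 + inner ℝ (ν x) v ^ 2 = ‖v‖ ^ 2) ∧
      ∀ v, inner ℝ (gradient f x) v = 0 → ‖gradient f x‖⁻¹ * fderiv ℝ (fderiv ℝ f) x v v =
        ∑ l, (‖gradient f x‖⁻¹ * fderiv ℝ (fderiv ℝ f) x (e l) (e l)) * inner ℝ (e l) v ^ 2 := by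
  have hG0 := h.gradient_ne_zero
  have hνx : ν x = ‖gradient f x‖⁻¹ • gradient f x := hν.self_of_nhds hx
  have hν1 : ‖ν x‖ = 1 := by rw [hνx]; exact norm_smul_inv_norm hG0
  have hν0 : ν x ≠ 0 := norm_ne_zero_iff.1 (by rw [hν1]; exact one_ne_zero)
  have hsymmB : ∀ u v, fderiv ℝ (fderiv ℝ f) x u v = fderiv ℝ (fderiv ℝ f) x v u :=
    h.contDiffAt.isSymmSndFDerivAt (by simp)
  have hsymm : (shapeOperator S ν x).IsSymmetric := fun v u => by
    rw [inner_shapeOperator h hx hν, real_inner_comm, inner_shapeOperator h hx hν, hsymmB]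
  have : Fact (Module.finrank ℝ (E n) = n + 1) := ⟨by simp⟩
  have hdim : Module.finrank ℝ (ℝ ∙ ν x)ᗮ = n := Submodule.finrank_orthogonal_span_singleton hν0
  set b := hsymm.eigenvectorBasis hdim with hb
  set μ := hsymm.eigenvalues hdim with hμ
  have hAb : ∀ j, shapeOperator S ν x (b j) = μ j • b j := fun j =>
    hsymm.apply_eigenvectorBasis hdim j
  have hμj : ∀ j, ‖gradient f x‖⁻¹ * fderiv ℝ (fderiv ℝ f) x (b j) (b j) = μ j := fun j => by
    rw [← inner_shapeOperator h hx hν, hAb, real_inner_smul_left, real_inner_self_eq_norm_sq,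
      b.orthonormal.1 j]
    ring
  have horth : ∀ w : (ℝ ∙ ν x)ᗮ, inner ℝ (gradient f x) (w : E n) = 0 := fun w => by
    have : ‖gradient f x‖⁻¹ * inner ℝ (gradient f x) (w : E n) = 0 := by
      rw [← real_inner_smul_left, ← hνx]
      exact Submodule.mem_orthogonal_singleton_iff_inner_right.1 w.2
    exact (mul_eq_zero.1 this).resolve_left (inv_ne_zero (norm_ne_zero_iff.2 hG0))
  have hmem : ∀ v, inner ℝ (gradient f x) v = 0 → v ∈ (ℝ ∙ ν x)ᗮ := fun v hv => by
    rw [Submodule.mem_orthogonal_singleton_iff_inner_right, hνx, real_inner_smul_left, hv, mul_zero]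
  refine ⟨fun j => b j, b.orthonormal.comp_linearIsometry (ℝ ∙ ν x)ᗮ.subtypeₗᵢ,
    fun j => horth _, ?_, fun v => ?_, fun v hv => ?_⟩
  · rw [gaussianCurvature, hsymm.det_eq_prod_eigenvalues hdim]
    exact Finset.prod_congr rfl fun j _ => (hμj j).symm
  · set a := inner ℝ (ν x) v with ha
    have hw : inner ℝ (gradient f x) (v - a • ν x) = 0 := by
      have hG : gradient f x = ‖gradient f x‖ • ν x := by
        rw [hνx, smul_smul, mul_inv_cancel₀ (norm_ne_zero_iff.2 hG0), one_smul]
      rw [hG, real_inner_smul_left, inner_sub_right, inner_smul_right, real_inner_self_eq_norm_sq,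
        hν1, ha]
      ring
    have hνb : ∀ l, inner ℝ (b l : E n) (ν x) = 0 := fun l =>
      Submodule.mem_orthogonal_singleton_iff_inner_left.1 (b l).2
    have h1 := b.sum_sq_inner_right ⟨v - a • ν x, hmem _ hw⟩
    have h2 : ∀ l, inner ℝ (b l) (⟨v - a • ν x, hmem _ hw⟩ : (ℝ ∙ ν x)ᗮ)
        = inner ℝ (b l : E n) v := fun l => by
      rw [Submodule.coe_inner, inner_sub_right, inner_smul_right, hνb]
      ring
    simp only [h2] at h1
    rw [h1, Submodule.coe_norm, @norm_sub_sq_real, inner_smul_right, norm_smul, hν1,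
      Real.norm_eq_abs, mul_one, sq_abs, real_inner_comm, ← ha]
    ring
  · have h1 := inner_shapeOperator h hx hν ⟨v, hmem v hv⟩ ⟨v, hmem v hv⟩
    simp only at h1
    rw [← h1, ← b.sum_inner_mul_inner]
    refine Finset.sum_congr rfl fun l _ => ?_
    rw [hμj, hsymm, hAb, inner_smul_right, Submodule.coe_inner, Submodule.coe_inner]
    simp only [real_inner_comm v]
    ring

end curvature

/-! ### Osculating quadrics at a point of positive curvature -/

section localForm

variable {n : ℕ} {K : Set (E n)} {f : E n → ℝ} {x q : E n}

/-- A defining function of a convex body has nonnegative second derivative along the boundary. -/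
lemma IsLocalEquation.hessian_nonneg (h : IsLocalEquation (frontier K) f x)
    (hK : Convex ℝ K) (hKc : IsClosed K) (hq : q ∈ interior K) (hx : x ∈ frontier K)
    (hqx : fderiv ℝ f x (q - x) < 0) {v : E n} (hv : inner ℝ (gradient f x) v = 0) :
    0 ≤ fderiv ℝ (fderiv ℝ f) x v v := by
  by_contra hneg
  rw [not_le] at hneg
  set b := fderiv ℝ (fderiv ℝ f) x v v with hb
  have hη : 0 < -b / (4 * (‖v‖ ^ 2 + 1)) := div_pos (by linarith) (by positivity)
  obtain ⟨δ, hδ, H⟩ := h.contDiffAt.uniform_taylor_two hη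
  obtain ⟨m, hm1, hm⟩ := exists_supporting_vector hK hq hx
  have hfx : f x = 0 := h.mem_iff.self_of_nhds.1 hx
  have hpath : Tendsto (fun t : ℝ => x + t • v) (𝓝[>] 0) (𝓝 x) := by
    have : Continuous fun t : ℝ => x + t • v := by fun_prop
    have h2 := this.tendsto 0
    simp only [zero_smul, add_zero] at h2
    exact h2.mono_left nhdsWithin_le_nhds
  have h1 := (h.eventually_mem_iff hK hKc hq hx hqx).eventually_nhds
  have h2 : ∀ᶠ y in 𝓝 x, ContinuousAt f y :=
    (h.contDiffAt.eventually (by simp)).mono fun y hy => hy.continuousAt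
  obtain ⟨t, ⟨ht1, ht2, htb⟩, ht0⟩ := ((hpath.eventually (h1.and (h2.and
    (Metric.ball_mem_nhds x hδ)))).and self_mem_nhdsWithin).exists
  have ht0 : 0 < t := ht0
  rw [dist_eq_norm] at htb
  have h3 := (abs_le.1 (H x (t • v) (by simpa using hδ) htb)).2
  rw [hfx, IsLocalEquation.fderiv_apply, inner_smul_right, hv, norm_smul, mul_pow,
    Real.norm_eq_abs, sq_abs] at h3
  simp only [map_smul, smul_apply, smul_eq_mul, ← hb] at h3
  have h4 : -b / (4 * (‖v‖ ^ 2 + 1)) * (t ^ 2 * ‖v‖ ^ 2) ≤ -b / 4 * t ^ 2 := by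
    rw [div_mul_eq_mul_div, div_le_iff₀ (by positivity)]
    nlinarith [mul_pos (neg_pos.2 hneg) (pow_pos ht0 2)]
  -- A negative second derivative moves a tangential path into the interior, where a supporting
  -- vector is strictly negative; but `m` is parallel to the gradient and vanishes on `v`.
  have h5 : f (x + t • v) < 0 := by nlinarith [mul_pos (neg_pos.2 hneg) (pow_pos ht0 2)]
  have h6 : x + t • v ∈ interior K := by
    rw [mem_interior_iff_mem_nhds]
    filter_upwards [ht1, ht2.eventually_lt_const h5] with z hz1 hz2
    exact hz1.2 hz2.le
  have hm0 : m ≠ 0 := norm_ne_zero_iff.1 (by rw [hm1]; exact one_ne_zero)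
  have h7 := inner_lt_zero_of_mem_interior hm0 hm h6
  rw [h.eq_norm_smul hKc (interior_subset hq) hx hqx hm, add_sub_cancel_left, real_inner_smul_left,
    real_inner_smul_left, inner_smul_right, hv] at h7
  simp at h7

/-- The curvature condition at a boundary point in terms of a quadratic form, which is the second
fundamental form in the tangential directions and large in the normal direction. -/
lemma IsLocalEquation.exists_form (hn : 1 ≤ n) (h : IsLocalEquation (frontier K) f x)
    (hK : Convex ℝ K) (hKc : IsClosed K) (hq : q ∈ interior K) (hx : x ∈ frontier K)
    (hqx : fderiv ℝ f x (q - x) < 0) {g : ℝ} (hg : 0 < g)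
    (hcurv : g ^ n ≤ gaussianCurvature (frontier K) (outwardNormal K) x) :
    ∃ (H : E n → ℝ) (c M L : ℝ), 0 < c ∧ 0 ≤ L ∧ IsFormBetween n g c M H ∧
      ∀ w, ‖gradient f x‖ * H w -
        L * |inner ℝ (‖gradient f x‖⁻¹ • gradient f x) w| * ‖w‖ ≤
          fderiv ℝ (fderiv ℝ f) x w w := by
  have hν : ∀ᶠ y in 𝓝 x, y ∈ frontier K →
      outwardNormal K y = ‖gradient f y‖⁻¹ • gradient f y := by
    filter_upwards [h.eventually, h.eventually_fderiv_neg hqx] with y hy hyq hyS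
    exact hy.outwardNormal_eq hK hKc hq hyS hyq
  obtain ⟨e, he, heG, hdet, hP, hform⟩ := exists_principal_basis h hx hν
  set B := fderiv ℝ (fderiv ℝ f) x with hB
  set γ := ‖gradient f x‖ with hγ
  have hγ0 : 0 < γ := norm_pos_iff.2 h.gradient_ne_zero
  rw [hν.self_of_nhds hx] at hP
  set N := γ⁻¹ • gradient f x with hN
  have hN1 : ‖N‖ = 1 := norm_smul_inv_norm h.gradient_ne_zero
  set κ : Fin n → ℝ := fun l => γ⁻¹ * B (e l) (e l) with hκ
  have hκ0 : ∀ l, 0 ≤ κ l := fun l => mul_nonneg (inv_nonneg.2 hγ0.le)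
    (h.hessian_nonneg hK hKc hq hx hqx (heG l))
  have hprod : g ^ n ≤ ∏ l, κ l := hdet ▸ hcurv
  have hκpos : ∀ l, 0 < κ l := fun l => (hκ0 l).lt_of_ne' fun hl => by
    have : ∏ l, κ l = 0 := Finset.prod_eq_zero (Finset.mem_univ l) hl
    have hgn := pow_pos hg n
    linarith
  have : Nonempty (Fin n) := ⟨⟨0, hn⟩⟩
  obtain ⟨l₀, hl₀⟩ := Finite.exists_min κ
  obtain ⟨l₁, hl₁⟩ := Finite.exists_max κ
  have hM0 : 0 < κ l₁ := hκpos l₁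
  have hlog : n * Real.log g ≤ ∑ l, Real.log (κ l) := by
    rw [← Real.log_prod fun l _ => (hκpos l).ne', ← Real.log_pow]
    exact Real.log_le_log (pow_pos hg n) hprod
  -- The normal coefficient is the largest principal curvature. `L` pays for this choice by `γ * κ
  -- l₁` and for the terms of `B` involving `N` by `2 * ‖B‖` and `‖B‖`.
  refine ⟨_, κ l₀, κ l₁, γ * κ l₁ + 3 * ‖B‖, hκpos l₀, by positivity,
    isFormBetween_diagonal hg (hκpos l₀) e N he hP κ hl₀ hl₁ (hl₀ l₁) hlog, fun w => ?_⟩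
  set a := inner ℝ N w with ha
  have hG : gradient f x = γ • N := by
    rw [hN, smul_smul, mul_inv_cancel₀ hγ0.ne', one_smul]
  have heN : ∀ l, inner ℝ (e l) N = 0 := fun l => by
    rw [hN, inner_smul_right, real_inner_comm, heG, mul_zero]
  have haw : |a| ≤ ‖w‖ := by
    have := abs_real_inner_le_norm N w
    rwa [hN1, one_mul] at this
  have hw0 : inner ℝ (gradient f x) (w - a • N) = 0 := by
    rw [hG, real_inner_smul_left, inner_sub_right, inner_smul_right, real_inner_self_eq_norm_sq,
      hN1]
    ring
  have h1 : γ⁻¹ * B (w - a • N) (w - a • N) = ∑ l, κ l * inner ℝ (e l) w ^ 2 := by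
    rw [hform _ hw0]
    refine Finset.sum_congr rfl fun l _ => ?_
    rw [inner_sub_right, inner_smul_right, heN, mul_zero, sub_zero]
  have h2 : B w w = B (w - a • N) (w - a • N) + a * B (w - a • N) N + a * B N w := by
    simp only [map_sub, map_smul, sub_apply, smul_apply, smul_eq_mul]
    ring
  have hwN : ‖w - a • N‖ ≤ 2 * ‖w‖ := by
    refine (norm_sub_le _ _).trans ?_
    rw [norm_smul, hN1, Real.norm_eq_abs]
    linarith
  have h3 : |a * B (w - a • N) N| ≤ |a| * (2 * ‖B‖ * ‖w‖) := by
    rw [abs_mul]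
    refine mul_le_mul_of_nonneg_left ?_ (abs_nonneg a)
    have := B.le_opNorm₂ (w - a • N) N
    rw [hN1, mul_one, Real.norm_eq_abs] at this
    refine this.trans ?_
    nlinarith [norm_nonneg B]
  have h4 : |a * B N w| ≤ |a| * (‖B‖ * ‖w‖) := by
    rw [abs_mul]
    refine mul_le_mul_of_nonneg_left ?_ (abs_nonneg a)
    have := B.le_opNorm₂ N w
    rwa [hN1, mul_one, Real.norm_eq_abs] at this
  have h5 : γ * κ l₁ * a ^ 2 ≤ γ * κ l₁ * (|a| * ‖w‖) := by
    rw [← sq_abs]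
    refine mul_le_mul_of_nonneg_left ?_ (by positivity)
    nlinarith [abs_nonneg a]
  have h6 : B (w - a • N) (w - a • N) = γ * ∑ l, κ l * inner ℝ (e l) w ^ 2 := by
    rw [← h1]
    field_simp
  rw [h2, h6]
  have h7 := neg_abs_le (a * B (w - a • N) N)
  have h8 := neg_abs_le (a * B N w)
  linarith

lemma mul_div_mul_add_one_le {L X d : ℝ} (hL : 0 ≤ L) (hX : 0 ≤ X) (hd : 0 < d) :
    L * (X / (d * (L + 1))) ≤ X / d := by
  rw [mul_div_assoc', div_le_div_iff₀ (by positivity) hd]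
  have : 0 ≤ X * d := by positivity
  linarith

/-- Here `t` is the depth of `y` below the tangent plane at `p`, `W` is the length of `y - p`, and
`a` its component along the normal at `x`. The error `L * |a| * W` splits into a multiple of `t`,
small because `W` is small, and a multiple of `W ^ 2`, absorbed by `Hw ≥ c * W ^ 2`. -/
lemma quadric_estimate {η γ c L τ γp t a W Hw Bw F : ℝ} (hη : 0 < η) (hη1 : η < 1) (hγ : 0 < γ)
    (hL : 0 ≤ L) (hγp : γp ≤ γ * (1 + η / 4)) (ht : 0 ≤ t) (ha : |a| ≤ t + τ * W)
    (hLτ : L * τ ≤ η * γ * c / 4) (hLW : L * W ≤ γ * η / 2) (hW : 0 ≤ W) (hHw : c * W ^ 2 ≤ Hw)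
    (hBw : γ * Hw - L * |a| * W ≤ Bw) (hc : 0 < c)
    (htay : -(η * γ * c / 8 * W ^ 2) ≤ F - 0 - γp * -t - 1 / 2 * Bw) (hF : F ≤ 0) :
    (1 - η) * Hw ≤ 2 * t := by
  have hstep : L * |a| * W ≤ L * (t + τ * W) * W := by gcongr
  have hX : L * (t + τ * W) * W ≤ γ * η / 2 * t + η * γ / 4 * Hw := by
    have h1 : L * W * t ≤ γ * η / 2 * t := mul_le_mul_of_nonneg_right hLW ht
    have h2 : L * τ * W ^ 2 ≤ η * γ * c / 4 * W ^ 2 :=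
      mul_le_mul_of_nonneg_right hLτ (sq_nonneg _)
    have h3 : η * γ / 4 * (c * W ^ 2) ≤ η * γ / 4 * Hw :=
      mul_le_mul_of_nonneg_left hHw (by positivity)
    linarith
  have hY : η * γ * c / 8 * W ^ 2 ≤ η * γ / 8 * Hw := by
    have h3 : η * γ / 8 * (c * W ^ 2) ≤ η * γ / 8 * Hw :=
      mul_le_mul_of_nonneg_left hHw (by positivity)
    linarith
  have hγt : γp * t ≤ γ * (1 + η / 4) * t := mul_le_mul_of_nonneg_right hγp ht
  have hfinal : γ * ((1 - η / 2) * Hw) ≤ γ * (2 * (1 + η / 2) * t) := by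
    linarith
  have hfinal' := le_of_mul_le_mul_left hfinal hγ
  have hH0 : 0 ≤ Hw := le_trans (by positivity) hHw
  have h1 : (1 + η / 2) * ((1 - η) * Hw) ≤ (1 - η / 2) * Hw := by
    have : 0 ≤ η * η * Hw := by positivity
    linarith
  have h2 : (1 + η / 2) * ((1 - η) * Hw) ≤ (1 + η / 2) * (2 * t) := by linarith
  exact le_of_mul_le_mul_left h2 (by linarith)

/-- Near a boundary point of positive curvature, a convex body lies below osculating quadrics. -/
lemma exists_local_quadric (hn : 1 ≤ n) (hS : IsSmoothHypersurfaceNear (frontier K) x)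
    (hK : Convex ℝ K) (hKc : IsClosed K) (hq : q ∈ interior K) (hx : x ∈ frontier K)
    {g : ℝ} (hg : 0 < g)
    (hcurv : g ^ n ≤ gaussianCurvature (frontier K) (outwardNormal K) x)
    {η : ℝ} (hη : 0 < η) (hη1 : η < 1) :
    ∃ (H : E n → ℝ) (c M δ : ℝ), 0 < c ∧ 0 < δ ∧ IsFormBetween n ((1 - η) * g) c M H ∧
      ∀ p ∈ K, ‖p - x‖ < δ → ∀ m : E n, (∀ y ∈ K, inner ℝ m (y - p) ≤ 0) →
        ∀ y ∈ K, ‖y - p‖ < δ → inner ℝ m (y - p) + 1 / 2 * ‖m‖ * H (y - p) ≤ 0 := by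
  obtain ⟨f, h, hqx⟩ := exists_isLocalEquation_neg hS hK hKc hq hx
  obtain ⟨H, c, M, L, hc, hL, hH, hB⟩ := h.exists_form hn hK hKc hq hx hqx hg hcurv
  set γ := ‖gradient f x‖ with hγ
  have hγ0 : 0 < γ := norm_pos_iff.2 h.gradient_ne_zero
  set B := fderiv ℝ (fderiv ℝ f) x with hBdef
  set N := γ⁻¹ • gradient f x with hN
  set η₁ := η * γ * c / 8 with hη₁
  set τ := η * γ * c / (4 * (L + 1)) with hτ
  have hη₁0 : 0 < η₁ := by positivity
  have hτ0 : 0 < τ := by positivity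
  obtain ⟨δ₁, hδ₁, hT⟩ := h.contDiffAt.uniform_taylor_two hη₁0
  have hgc : ContinuousAt (gradient f) x := by
    obtain ⟨D, hD, -⟩ := h.exists_hasFDerivAt_gradient
    exact hD.continuousAt
  have hNc : ContinuousAt (fun p => ‖gradient f p‖⁻¹ • gradient f p) x :=
    (hgc.norm.inv₀ hγ0.ne').smul hgc
  have hN' : ∀ᶠ p in 𝓝 x, ‖‖gradient f p‖⁻¹ • gradient f p - N‖ < τ := by
    have : ContinuousAt (fun p => ‖‖gradient f p‖⁻¹ • gradient f p - N‖) x :=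
      (hNc.sub continuousAt_const).norm
    refine this.eventually_lt_const ?_
    simpa [hN, hγ] using hτ0
  have hγ' : ∀ᶠ p in 𝓝 x, ‖gradient f p‖ < γ * (1 + η / 4) :=
    hgc.norm.eventually_lt_const (by nlinarith)
  obtain ⟨δ₂, hδ₂, H2⟩ := Metric.eventually_nhds_iff.1 ((h.eventually.and
    (h.eventually_fderiv_neg hqx)).and ((hN'.and hγ').and
      ((h.eventually_mem_iff hK hKc hq hx hqx).and h.mem_iff)))
  set δ := min (min δ₁ δ₂ / 2) (γ * η / (2 * (L + 1))) with hδ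
  have hδ0 : 0 < δ := by positivity
  refine ⟨fun v => (1 - η) * H v, (1 - η) * c, (1 - η) * M, δ, mul_pos (by linarith) hc, hδ0,
    hH.const_mul (by linarith), fun p hp hpx m hm y hy hyp => ?_⟩
  by_cases hm0 : m = 0
  · simp [hm0]
  have hpf : p ∈ frontier K := ⟨subset_closure hp, fun hpi => by
    have := inner_lt_zero_of_mem_interior hm0 hm hpi
    simp at this⟩
  have hδδ : δ ≤ min δ₁ δ₂ / 2 := min_le_left _ _
  have hδ1 : min δ₁ δ₂ ≤ δ₁ := min_le_left _ _
  have hδ2 : min δ₁ δ₂ ≤ δ₂ := min_le_right _ _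
  have hyx : ‖y - x‖ < min δ₁ δ₂ := by
    have : y - x = (y - p) + (p - x) := by abel
    rw [this]
    refine (norm_add_le _ _).trans_lt ?_
    linarith
  obtain ⟨⟨hp1, hp2⟩, ⟨hp3, hp4⟩, -, hp6⟩ := H2 (y := p) (by rw [dist_eq_norm]; linarith)
  have hy5 := (H2 (y := y) (by rw [dist_eq_norm]; linarith)).2.2.1.1 hy
  have hfp : f p = 0 := hp6.1 hpf
  set w := y - p with hw
  have hpw : p + w = y := by rw [hw]; abel
  have htay := (abs_le.1 (hT p w (by linarith) (by rw [hpw]; linarith))).1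
  rw [hpw, hfp, IsLocalEquation.fderiv_apply] at htay
  have hmN := hp1.eq_norm_smul hKc (interior_subset hq) hpf hp2 hm
  set γp := ‖gradient f p‖ with hγp
  have hγp0 : 0 < γp := norm_pos_iff.2 hp1.gradient_ne_zero
  set Np := γp⁻¹ • gradient f p with hNp
  have hGp : gradient f p = γp • Np := by
    rw [hNp, smul_smul, mul_inv_cancel₀ hγp0.ne', one_smul]
  rw [hGp, real_inner_smul_left] at htay
  have hmpos : 0 < ‖m‖ := norm_pos_iff.2 hm0
  have hmw := hm y hy
  rw [hmN, real_inner_smul_left] at hmw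
  have ht0 : inner ℝ Np w ≤ 0 := nonpos_of_mul_nonpos_right hmw hmpos
  obtain ⟨t, ht⟩ : ∃ t, t = -inner ℝ Np w := ⟨_, rfl⟩
  have htw : inner ℝ Np w = -t := by linarith
  have ha : |inner ℝ N w| ≤ t + τ * ‖w‖ := by
    have h1 : inner ℝ N w = inner ℝ Np w - inner ℝ (Np - N) w := by
      rw [inner_sub_left]; ring
    have h2 : |inner ℝ (Np - N) w| ≤ τ * ‖w‖ :=
      (abs_real_inner_le_norm _ _).trans (mul_le_mul_of_nonneg_right hp3.le (norm_nonneg _))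
    rw [h1, htw]
    refine (abs_sub _ _).trans ?_
    rw [abs_neg, abs_of_nonneg (by linarith : 0 ≤ t)]
    linarith
  have hBw := hB w
  have hHw := hH.lower w
  have hw0 := norm_nonneg w
  have hLτ : L * τ ≤ η * γ * c / 4 := mul_div_mul_add_one_le hL (by positivity) (by norm_num)
  have hLδ : L * ‖w‖ ≤ γ * η / 2 :=
    (mul_le_mul_of_nonneg_left (hyp.le.trans (min_le_right _ _)) hL).trans
      (mul_div_mul_add_one_le hL (by positivity) (by norm_num))
  have ht : 0 ≤ t := by linarith
  rw [htw] at htay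
  have hkey := quadric_estimate hη hη1 hγ0 hL hp4.le ht ha hLτ hLδ hw0 hHw hBw hc htay hy5
  have hinner : inner ℝ m w = -(‖m‖ * t) := by
    rw [hmN, real_inner_smul_left, htw, ← hmN]
    ring
  rw [hinner]
  linarith [mul_le_mul_of_nonneg_left hkey hmpos.le]

end localForm

/-! ### Uniform quadrics and the intersection -/

section quadric

variable {n : ℕ}

/-- For every point of `K` in `X` and every normal vector at this point, the convex body `K` lies
locally below a quadric, whose radius of validity and bounds are uniform. -/
def HasQuadrics (K X : Set (E n)) (g : ℝ) : Prop :=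
  ∃ c > 0, ∃ M > 0, ∃ δ > 0, ∀ p ∈ K ∩ X, ∀ m : E n, (∀ y ∈ K, inner ℝ m (y - p) ≤ 0) →
    ∃ H : E n → ℝ, IsFormBetween n g c M H ∧
      ∀ y ∈ K, ‖y - p‖ < δ → inner ℝ m (y - p) + 1 / 2 * ‖m‖ * H (y - p) ≤ 0

/-- The property passes to subsets and, by taking minima and maxima of the constants, to finite
unions, so local quadrics suffice. Away from the frontier the only normal vector is zero and any
form will do. -/
lemma hasQuadrics_of_isCompact (hn : 1 ≤ n) {K U X : Set (E n)} (hK : Convex ℝ K)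
    (hKc : IsClosed K) (hKi : (interior K).Nonempty) {g : ℝ} (hg : 0 < g)
    (h : ∀ x ∈ U ∩ frontier K, IsSmoothHypersurfaceNear (frontier K) x ∧
      g ^ n ≤ gaussianCurvature (frontier K) (outwardNormal K) x)
    (hX : IsCompact X) (hXU : X ⊆ U) {η : ℝ} (hη : 0 < η) (hη1 : η < 1) :
    HasQuadrics K X ((1 - η) * g) := by
  obtain ⟨q, hq⟩ := hKi
  have hg' : 0 < (1 - η) * g := mul_pos (by linarith) hg
  suffices H : ∃ c > 0, ∃ M > 0, ∃ δ > 0, ∀ p ∈ K ∩ X, ∀ m : E n,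
      (∀ y ∈ K, inner ℝ m (y - p) ≤ 0) → ∃ H : E n → ℝ, IsFormBetween n ((1 - η) * g) c M H ∧
      ∀ y ∈ K, ‖y - p‖ < δ → inner ℝ m (y - p) + 1 / 2 * ‖m‖ * H (y - p) ≤ 0 from H
  refine hX.induction_on (p := fun X => ∃ c > 0, ∃ M > 0, ∃ δ > 0, ∀ p ∈ K ∩ X, ∀ m : E n,
      (∀ y ∈ K, inner ℝ m (y - p) ≤ 0) → ∃ H : E n → ℝ, IsFormBetween n ((1 - η) * g) c M H ∧
      ∀ y ∈ K, ‖y - p‖ < δ → inner ℝ m (y - p) + 1 / 2 * ‖m‖ * H (y - p) ≤ 0)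
    ⟨1, one_pos, 1, one_pos, 1, one_pos, by simp⟩ ?_ ?_ ?_
  · rintro s t hst ⟨c, hc, M, hM, δ, hδ, H⟩
    exact ⟨c, hc, M, hM, δ, hδ, fun p hp => H p ⟨hp.1, hst hp.2⟩⟩
  · rintro s t ⟨c, hc, M, hM, δ, hδ, H⟩ ⟨c', hc', M', hM', δ', hδ', H'⟩
    refine ⟨min c c', lt_min hc hc', max M M', lt_max_of_lt_left hM, min δ δ', lt_min hδ hδ',
      fun p hp m hm => ?_⟩
    rcases hp.2 with hps | hpt
    · obtain ⟨F, hF, hF'⟩ := H p ⟨hp.1, hps⟩ m hm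
      exact ⟨F, hF.mono (min_le_left _ _) (le_max_left _ _),
        fun y hy hyp => hF' y hy (hyp.trans_le (min_le_left _ _))⟩
    · obtain ⟨F, hF, hF'⟩ := H' p ⟨hp.1, hpt⟩ m hm
      exact ⟨F, hF.mono (min_le_right _ _) (le_max_right _ _),
        fun y hy hyp => hF' y hy (hyp.trans_le (min_le_right _ _))⟩
  · intro x hxX
    by_cases hxf : x ∈ frontier K
    · obtain ⟨hS, hcurv⟩ := h x ⟨hXU hxX, hxf⟩
      obtain ⟨F, c, M, δ, hc, hδ, hF, hF'⟩ :=
        exists_local_quadric hn hS hK hKc hq hxf hg hcurv hη hη1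
      refine ⟨Metric.ball x δ, mem_nhdsWithin_of_mem_nhds (Metric.ball_mem_nhds x hδ),
        c, hc, max M 1, lt_max_of_lt_right one_pos, δ, hδ, fun p hp m hm =>
        ⟨F, hF.mono le_rfl (le_max_left _ _), hF' p hp.1 (mem_ball_iff_norm.1 hp.2) m hm⟩⟩
    · refine ⟨(frontier K)ᶜ, mem_nhdsWithin_of_mem_nhds
        (isClosed_frontier.isOpen_compl.mem_nhds hxf), (1 - η) * g, hg', (1 - η) * g, hg', 1,
        one_pos, fun p hp m hm => ⟨_, isFormBetween_norm_sq hg' le_rfl le_rfl, fun y hy hyp => ?_⟩⟩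
      have hm0 : m = 0 := by
        by_contra hm0
        have hpi : p ∈ interior K := by
          by_contra hpi
          exact hp.2 ⟨subset_closure hp.1, hpi⟩
        have := inner_lt_zero_of_mem_interior hm0 hm hpi
        simp at this
      simp [hm0]

/-- The normal cone of an intersection is the sum of the normal cones. -/
lemma exists_normal_add {K₁ K₂ : Set (E n)} (h₁ : Convex ℝ K₁) (h₂ : Convex ℝ K₂)
    (hK : (interior (K₁ ∩ K₂)).Nonempty) {p ν : E n} (hp : p ∈ K₁ ∩ K₂)
    (hν : ∀ y ∈ K₁ ∩ K₂, inner ℝ ν (y - p) ≤ 0) :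
    ∃ m₁ m₂ : E n, ν = m₁ + m₂ ∧ (∀ y ∈ K₁, inner ℝ m₁ (y - p) ≤ 0) ∧
      ∀ y ∈ K₂, inner ℝ m₂ (y - p) ≤ 0 := by
  obtain ⟨q, hq⟩ := hK
  rw [interior_inter] at hq
  -- The part of `K₁ × ℝ` below the graph of `ν` misses `B` because `ν` is nonpositive on the
  -- intersection. The horizontal part of a separating functional, divided by minus its vertical
  -- coefficient, is normal to `K₂` at `p`, and the rest of `ν` is normal to `K₁`.
  set A : Set (E n × ℝ) := {z | z.1 ∈ K₁ ∧ z.2 ≤ inner ℝ ν (z.1 - p)} with hA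
  set B : Set (E n × ℝ) := interior K₂ ×ˢ Set.Ioi 0 with hB
  have hAc : Convex ℝ A := by
    rintro ⟨y, s⟩ ⟨hy, hs⟩ ⟨z, t⟩ ⟨hz, ht⟩ a b ha hb hab
    refine ⟨h₁ hy hz ha hb hab, ?_⟩
    simp only [Prod.smul_mk, Prod.mk_add_mk, smul_eq_mul] at hs ht ⊢
    have h3 : a • y + b • z - p = a • (y - p) + b • (z - p) := by
      have : p = (a + b) • p := by rw [hab, one_smul]
      nth_rewrite 1 [this]
      module
    rw [h3, inner_add_right, inner_smul_right, inner_smul_right]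
    exact add_le_add (mul_le_mul_of_nonneg_left hs ha) (mul_le_mul_of_nonneg_left ht hb)
  have hBc : Convex ℝ B := h₂.interior.prod (convex_Ioi 0)
  have hBo : IsOpen B := isOpen_interior.prod isOpen_Ioi
  have hdisj : Disjoint B A := by
    rw [Set.disjoint_left]
    rintro ⟨y, s⟩ ⟨hy, hs⟩ ⟨hy', hs'⟩
    have := hν y ⟨hy', interior_subset hy⟩
    simp only [Set.mem_Ioi] at hs
    simp only at hs'
    linarith
  obtain ⟨φ, u, hφB, hφA⟩ := geometric_hahn_banach_open hBc hBo hAc hdisj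
  set ℓ : StrongDual ℝ (E n) := φ.comp (ContinuousLinearMap.inl ℝ (E n) ℝ) with hℓ
  set c := φ (0, 1) with hc
  have hφ : ∀ y s, φ (y, s) = ℓ y + s * c := fun y s => by
    have : ((y, s) : E n × ℝ) = (y, 0) + s • (0, 1) := by simp
    rw [this, map_add, map_smul, smul_eq_mul, hℓ, hc]
    simp
  have hAle : ∀ y ∈ K₁, u ≤ ℓ y + inner ℝ ν (y - p) * c := fun y hy => by
    rw [← hφ]
    exact hφA _ ⟨hy, le_rfl⟩
  have hBint : ∀ y ∈ interior K₂, ∀ s > 0, ℓ y + s * c < u := fun y hy s hs => by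
    rw [← hφ]
    exact hφB _ ⟨hy, hs⟩
  have hBle : ∀ y ∈ K₂, ℓ y ≤ u := by
    have h3 : ∀ y ∈ interior K₂, ℓ y ≤ u := fun y hy => by
      have ht : Tendsto (fun s : ℝ => ℓ y + s * c) (𝓝[>] 0) (𝓝 (ℓ y)) := by
        have : Continuous fun s : ℝ => ℓ y + s * c := by fun_prop
        have h4 := this.tendsto 0
        simp only [zero_mul, add_zero] at h4
        exact h4.mono_left nhdsWithin_le_nhds
      exact le_of_tendsto ht (eventually_of_mem self_mem_nhdsWithin fun s hs => (hBint y hy s hs).le)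
    intro y hy
    have h5 : y ∈ closure (interior K₂) := by
      rw [h₂.closure_interior_eq_closure_of_nonempty_interior ⟨q, hq.2⟩]
      exact subset_closure hy
    exact closure_minimal h3 (isClosed_Iic.preimage ℓ.continuous) h5
  have hup : ℓ p = u := by
    have h3 := hAle p hp.1
    rw [sub_self, inner_zero_right, zero_mul, add_zero] at h3
    exact le_antisymm (hBle p hp.2) h3
  -- The separating hyperplane is not vertical: the vertical line through `q` meets `A`, and above
  -- that point it meets `B`.
  have hcneg : c < 0 := by
    have h3 := hφA (q, min (inner ℝ ν (q - p)) (-1)) ⟨interior_subset hq.1, min_le_left _ _⟩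
    have h4 := hBint q hq.2 1 one_pos
    rw [hφ] at h3
    have h5 : min (inner ℝ ν (q - p)) (-1) ≤ -1 := min_le_right _ _
    by_contra hc0
    nlinarith
  set w := (InnerProductSpace.toDual ℝ (E n)).symm ℓ with hw
  have hwℓ : ∀ y, inner ℝ w y = ℓ y := fun y => by rw [hw, InnerProductSpace.toDual_symm_apply]
  refine ⟨ν - (-c)⁻¹ • w, (-c)⁻¹ • w, by abel, fun y hy => ?_, fun y hy => ?_⟩
  · have h3 := hAle y hy
    rw [← hup] at h3
    have h4 : 0 < -c := by linarith
    rw [inner_sub_left, real_inner_smul_left, hwℓ, map_sub, sub_nonpos, inv_mul_eq_div,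
      le_div_iff₀ h4]
    linarith
  · rw [real_inner_smul_left, hwℓ, map_sub]
    have h3 := hBle y hy
    exact mul_nonpos_of_nonneg_of_nonpos (inv_nonneg.2 (by linarith)) (by linarith)

/-- The quadrics of the two components of `ν` are added with weights `‖m₁‖` and `‖m₂‖`. The weights
sum to at least one by the triangle inequality, and stay bounded because `K₁ ∩ K₂` contains a ball,
which prevents long components from cancelling. -/
lemma HasQuadrics.inter {K₁ K₂ X : Set (E n)} {g : ℝ} (hg : 0 ≤ g) (H₁ : HasQuadrics K₁ X g)
    (H₂ : HasQuadrics K₂ X g) (h₁ : Convex ℝ K₁) (h₂ : Convex ℝ K₂)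
    (hK : (interior (K₁ ∩ K₂)).Nonempty) (hb : Bornology.IsBounded (K₁ ∩ K₂)) :
    ∃ c > 0, ∃ M > 0, ∃ δ > 0, ∀ p ∈ K₁ ∩ K₂ ∩ X, ∀ ν : E n, ‖ν‖ = 1 →
      (∀ y ∈ K₁ ∩ K₂, inner ℝ ν (y - p) ≤ 0) →
      ∃ H : E n → ℝ, IsFormBetween n g c M H ∧
        ∀ y ∈ K₁ ∩ K₂, ‖y - p‖ < δ → inner ℝ ν (y - p) + 1 / 2 * H (y - p) ≤ 0 := by
  obtain ⟨c, hc, M, hM, δ, hδ, H⟩ := H₁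
  obtain ⟨c', hc', M', hM', δ', hδ', H'⟩ := H₂
  have hK' := hK
  obtain ⟨q, hq⟩ := hK
  obtain ⟨ε, hε, hball⟩ := Metric.mem_nhds_iff.1 (mem_interior_iff_mem_nhds.1 hq)
  obtain ⟨D, hD⟩ := hb.exists_norm_le
  have hqK := interior_subset hq
  have hD0 : 0 ≤ D := (norm_nonneg q).trans (hD q hqK)
  set R := 4 * D / ε + 1 with hR
  have hR0 : 0 < R := by positivity
  have hnormal : ∀ (p m : E n), (∀ y ∈ K₁ ∩ K₂, inner ℝ m (y - p) ≤ 0) →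
      ε / 2 * ‖m‖ ≤ inner ℝ m (p - q) := by
    intro p m hm
    by_cases hm0 : m = 0
    · simp [hm0]
    have hmpos : 0 < ‖m‖ := norm_pos_iff.2 hm0
    have hmem : q + (ε / 2 * ‖m‖⁻¹) • m ∈ K₁ ∩ K₂ := hball <| by
      rw [mem_ball_iff_norm, add_sub_cancel_left, norm_smul, norm_mul, norm_inv, norm_norm,
        mul_assoc, inv_mul_cancel₀ hmpos.ne', Real.norm_eq_abs, abs_of_pos (by positivity)]
      linarith
    have h3 := hm _ hmem
    have h4 : q + (ε / 2 * ‖m‖⁻¹) • m - p = (ε / 2 * ‖m‖⁻¹) • m - (p - q) := by abel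
    rw [h4, inner_sub_right, inner_smul_right, real_inner_self_eq_norm_sq] at h3
    have h5 : ε / 2 * ‖m‖⁻¹ * ‖m‖ ^ 2 = ε / 2 * ‖m‖ := by field_simp
    linarith
  refine ⟨min c c', lt_min hc hc', R * max M M', mul_pos hR0 (lt_max_of_lt_left hM), min δ δ',
    lt_min hδ hδ', fun p hp ν hν1 hν => ?_⟩
  obtain ⟨m₁, m₂, hm, hm₁, hm₂⟩ := exists_normal_add h₁ h₂ hK' hp.1 hν
  obtain ⟨F, hF, hFle⟩ := H p ⟨hp.1.1, hp.2⟩ m₁ hm₁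
  obtain ⟨F', hF', hFle'⟩ := H' p ⟨hp.1.2, hp.2⟩ m₂ hm₂
  have hab : 1 ≤ ‖m₁‖ + ‖m₂‖ := by
    rw [← hν1, hm]
    exact norm_add_le _ _
  have habR : ‖m₁‖ + ‖m₂‖ ≤ R := by
    have h3 := hnormal p m₁ fun y hy => hm₁ y hy.1
    have h4 := hnormal p m₂ fun y hy => hm₂ y hy.2
    have h5 : inner ℝ m₁ (p - q) + inner ℝ m₂ (p - q) ≤ 2 * D := by
      rw [← inner_add_left, ← hm]
      refine (real_inner_le_norm _ _).trans ?_
      rw [hν1, one_mul]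
      refine (norm_sub_le _ _).trans ?_
      linarith [hD p hp.1, hD q hqK]
    have h6 : ‖m₁‖ + ‖m₂‖ ≤ 4 * D / ε := by
      rw [le_div_iff₀ hε]
      linarith
    linarith
  refine ⟨_, (hF.mono (min_le_left c c') (le_max_left M M')).combination
    (hF'.mono (min_le_right c c') (le_max_right M M')) hg (lt_min hc hc').le
    (lt_max_of_lt_left hM).le (norm_nonneg m₁) (norm_nonneg m₂) hab habR, fun y hy hyp => ?_⟩
  have h3 := hFle y hy.1 (hyp.trans_le (min_le_left _ _))
  have h4 := hFle' y hy.2 (hyp.trans_le (min_le_right _ _))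
  rw [hm, inner_add_left]
  linarith

end quadric

/-! ### The distance function of a convex body below quadrics -/

section distance

variable {n : ℕ} {K : Set (E n)}

/-- `p` is the point of `K` nearest to `z`. -/
structure IsNearest (K : Set (E n)) (z p : E n) : Prop where
  mem : p ∈ K
  infDist_eq : Metric.infDist z K = ‖z - p‖
  inner_le : ∀ y ∈ K, inner ℝ (z - p) (y - p) ≤ 0

lemma exists_isNearest (hK : IsCompact K) (hKc : Convex ℝ K) (hne : K.Nonempty) (z : E n) :
    ∃ p, IsNearest K z p := by
  obtain ⟨p, hp, hd⟩ := hK.exists_infDist_eq_dist hne z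
  refine ⟨p, hp, by rw [hd, dist_eq_norm], ?_⟩
  rw [← norm_eq_iInf_iff_real_inner_le_zero hKc hp, ← dist_eq_norm, ← hd, Metric.infDist_eq_iInf]
  simp only [dist_eq_norm]

lemma convexOn_infDist (hK : IsCompact K) (hKc : Convex ℝ K) (hne : K.Nonempty) :
    ConvexOn ℝ Set.univ fun z => Metric.infDist z K := by
  refine ⟨convex_univ, fun z _ z' _ a b ha hb hab => ?_⟩
  obtain ⟨p, hp⟩ := exists_isNearest hK hKc hne z
  obtain ⟨p', hp'⟩ := exists_isNearest hK hKc hne z'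
  simp only [smul_eq_mul]
  rw [hp.infDist_eq, hp'.infDist_eq]
  refine (Metric.infDist_le_dist_of_mem (hKc hp.mem hp'.mem ha hb hab)).trans ?_
  rw [dist_eq_norm]
  have : a • z + b • z' - (a • p + b • p') = a • (z - p) + b • (z' - p') := by module
  rw [this]
  refine (norm_add_le _ _).trans ?_
  rw [norm_smul, norm_smul, Real.norm_of_nonneg ha, Real.norm_of_nonneg hb]

namespace IsNearest

variable {z p z' p' : E n}

lemma norm_sub_le (h : IsNearest K z p) (h' : IsNearest K z' p') : ‖p' - p‖ ≤ ‖z' - z‖ := by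
  have h1 := h.inner_le p' h'.mem
  have h2 := h'.inner_le p h.mem
  have h3 : ‖p' - p‖ ^ 2 ≤ inner ℝ (z' - z) (p' - p) := by
    have h4 : inner ℝ (z' - p') (p - p') = -inner ℝ (z' - p') (p' - p) := by
      rw [← inner_neg_right, neg_sub]
    have h5 : z' - z = (z' - p') - (z - p) + (p' - p) := by abel
    rw [h5, inner_add_left, inner_sub_left, real_inner_self_eq_norm_sq]
    linarith
  have h6 := h3.trans (real_inner_le_norm _ _)
  by_contra hlt
  rw [not_le] at hlt
  nlinarith [norm_nonneg (z' - z)]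

/-- The distance function lies above its supporting affine functions. -/
lemma le_infDist (h : IsNearest K z p) (h' : IsNearest K z' p') :
    ‖z - p‖ ^ 2 + inner ℝ (z - p) (z' - z) ≤ ‖z - p‖ * Metric.infDist z' K := by
  rw [h'.infDist_eq]
  refine le_trans ?_ (real_inner_le_norm (z - p) (z' - p'))
  have h1 : z' - p' = (z - p) + (z' - z) - (p' - p) := by abel
  rw [h1, inner_sub_right _ (z - p + (z' - z)), inner_add_right, real_inner_self_eq_norm_sq]
  linarith [h.inner_le p' h'.mem]

end IsNearest

/-- `U` is the new distance, `V` its component along the old normal, and `D` the squared length of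
the difference between the step and the move of the nearest point. The part `U ^ 2 - V ^ 2` of `D`
is at most `4 * r * (U - V)`, so for small `r` it is paid by the gain of `U` over `V`. The part `(a
+ t) ^ 2` costs `2 * C * a ^ 2` and a fraction `η ^ 2` of `t`, left free by `(1 - η) * (1 + η) = 1 -
η ^ 2`. -/
lemma le_of_quadric_bounds {r a t U V Hh Hw D C η : ℝ} (hη : 0 < η) (hη1 : η < 1)
    (hC : 0 ≤ C) (hHh : Hh ≤ (1 + η) * Hw + 2 * C * D) (htw : 1 / 2 * Hw ≤ t) (ht0 : 0 ≤ t)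
    (hD0 : 0 ≤ D) (hV : V = r + a + t) (hD : D = U ^ 2 - V ^ 2 + (a + t) ^ 2) (hVU : V ≤ U)
    (hU : U ≤ 2 * r) (hr : 4 * r * C ≤ 1) (hCt : 2 * C * t ≤ η ^ 2) :
    r + a + 1 / 2 * (1 - η) * Hh - 2 * C * a ^ 2 ≤ U := by
  have h1 : U ^ 2 - V ^ 2 ≤ 4 * r * (U - V) := by nlinarith
  have h2 : C * (U ^ 2 - V ^ 2) ≤ U - V := by
    have := mul_le_mul_of_nonneg_left h1 hC
    nlinarith
  have h3 : C * (a + t) ^ 2 ≤ 2 * C * a ^ 2 + η ^ 2 * t := by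
    have h4 : C * (a + t) ^ 2 ≤ C * (2 * a ^ 2 + 2 * t ^ 2) :=
      mul_le_mul_of_nonneg_left (by nlinarith [sq_nonneg (a - t)]) hC
    have h5 := mul_le_mul_of_nonneg_right hCt ht0
    linarith
  have h6 : 1 / 2 * (1 - η) * Hh ≤ 1 / 2 * (1 - η) * ((1 + η) * Hw + 2 * C * D) :=
    mul_le_mul_of_nonneg_left hHh (by linarith)
  have h7 : (1 - η ^ 2) * (1 / 2 * Hw) ≤ (1 - η ^ 2) * t :=
    mul_le_mul_of_nonneg_left htw (by nlinarith)
  have h8 : (1 - η) * (C * D) ≤ C * D := by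
    have : 0 ≤ η * (C * D) := by positivity
    linarith
  have h9 : C * D = C * (U ^ 2 - V ^ 2) + C * (a + t) ^ 2 := by rw [hD]; ring
  linarith

/-- If `K` lies below a quadric at `p`, the distance function of `K` lies, up to a small error,
above the corresponding quadratic function at points of the normal through `p`. -/
lemma IsNearest.quadratic_le {z p : E n} (hz : IsNearest K z p) (hzp : 0 < ‖z - p‖)
    {H : E n → ℝ} {g c M δ : ℝ} (hc : 0 ≤ c) (hM : 0 ≤ M) (hH : IsFormBetween n g c M H)
    (hquad : ∀ y ∈ K, ‖y - p‖ < δ →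
      inner ℝ (‖z - p‖⁻¹ • (z - p)) (y - p) + 1 / 2 * H (y - p) ≤ 0)
    {η : ℝ} (hη : 0 < η) (hη1 : η < 1) {C : ℝ} (hC : C = 1 / 2 * (1 + η⁻¹) * M)
    (hr : 4 * ‖z - p‖ * C ≤ 1) {h y : E n} (hhδ : ‖h‖ < δ) (hhr : ‖h‖ ≤ ‖z - p‖)
    (hCh : 2 * C * ‖h‖ ≤ η ^ 2) (hy : IsNearest K (z + h) y) :
    ‖z - p‖ + inner ℝ (‖z - p‖⁻¹ • (z - p)) h + 1 / 2 * (1 - η) * H h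
      - 2 * C * inner ℝ (‖z - p‖⁻¹ • (z - p)) h ^ 2 ≤ Metric.infDist (z + h) K := by
  set r := ‖z - p‖ with hrdef
  set ν := r⁻¹ • (z - p) with hν
  have hν1 : ‖ν‖ = 1 := norm_smul_inv_norm (norm_pos_iff.1 hzp)
  have hzν : z - p = r • ν := by rw [hν, smul_smul, mul_inv_cancel₀ hzp.ne', one_smul]
  set w := y - p with hw
  have hwh : ‖w‖ ≤ ‖h‖ := by
    have := hz.norm_sub_le hy
    rwa [add_sub_cancel_left] at this
  have hq := hquad y hy.mem (hwh.trans_lt hhδ)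
  set t := -inner ℝ ν w with ht
  have hC0 : 0 ≤ C := by rw [hC]; positivity
  have hHw : 0 ≤ H w := le_trans (by positivity) (hH.lower w)
  have ht0 : 0 ≤ t := by rw [ht]; linarith
  have htw : t ≤ ‖w‖ := by
    have := abs_real_inner_le_norm ν w
    rw [hν1, one_mul] at this
    exact (neg_le_abs _).trans this
  have hu : z + h - y = r • ν + (h - w) := by rw [← hzν, hw]; abel
  have hsum : w + (h - w) = h := by abel
  have hHh : H h ≤ (1 + η) * H w + 2 * C * ‖h - w‖ ^ 2 := by
    have h1 := hH.add_le η hη w (h - w)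
    rw [hsum] at h1
    have h2 := mul_le_mul_of_nonneg_left (hH.upper (h - w)) (by positivity : 0 ≤ 1 + η⁻¹)
    rw [hC]
    linarith
  have hV : inner ℝ ν (z + h - y) = r + inner ℝ ν h + t := by
    rw [hu, inner_add_right, inner_smul_right, real_inner_self_eq_norm_sq, hν1, inner_sub_right, ht]
    ring
  have hD : ‖h - w‖ ^ 2 = ‖z + h - y‖ ^ 2 - inner ℝ ν (z + h - y) ^ 2
      + (inner ℝ ν h + t) ^ 2 := by
    have h1 : h - w = (z + h - y) - r • ν := by rw [hu]; abel
    have h2 : inner ℝ ν h + t = inner ℝ ν (z + h - y) - r := by rw [hV]; ring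
    rw [h2, h1, @norm_sub_sq_real, inner_smul_right, norm_smul, hν1, real_inner_comm,
      Real.norm_eq_abs, mul_one, sq_abs]
    ring
  have hVU : inner ℝ ν (z + h - y) ≤ ‖z + h - y‖ := by
    have := real_inner_le_norm ν (z + h - y)
    rwa [hν1, one_mul] at this
  have hU : ‖z + h - y‖ ≤ 2 * r := by
    rw [← hy.infDist_eq]
    refine (Metric.infDist_le_infDist_add_dist (s := K) (x := z + h) (y := z)).trans ?_
    rw [hz.infDist_eq, dist_eq_norm, add_sub_cancel_left]
    linarith
  rw [hy.infDist_eq]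
  refine le_of_quadric_bounds hη hη1 hC0 hHh (by rw [ht]; linarith) ht0 (sq_nonneg _) hV hD hVU hU
    hr ((mul_le_mul_of_nonneg_left (htw.trans hwh) (by positivity)).trans hCh)

/-- Lower bound for the traces of second differences of the distance function. -/
lemma trace_second_difference (hK : IsCompact K) (hKc : Convex ℝ K) {X : Set (E n)} {g c M δ : ℝ}
    (hc : 0 < c) (hM : 0 < M) (hδ : 0 < δ)
    (H : ∀ p ∈ K ∩ X, ∀ ν : E n, ‖ν‖ = 1 → (∀ y ∈ K, inner ℝ ν (y - p) ≤ 0) →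
      ∃ H : E n → ℝ, IsFormBetween n g c M H ∧
        ∀ y ∈ K, ‖y - p‖ < δ → inner ℝ ν (y - p) + 1 / 2 * H (y - p) ≤ 0)
    {η : ℝ} (hη : 0 < η) (hη1 : 2 * η < 1) :
    ∃ τ > 0, ∃ ρ > 0, ∃ t₀ > 0, ∀ z p, IsNearest K z p → p ∈ X → 0 < ‖z - p‖ → ‖z - p‖ ≤ ρ →
      ∀ e : Fin n → E n, Orthonormal ℝ e → (∀ j, |inner ℝ (z - p) (e j)| ≤ τ * ‖z - p‖) →
      ∀ β : Fin n → ℝ, (∀ j, 0 < β j) → ∑ j, Real.log (β j) = 0 →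
      ∀ t, 0 < t → t < t₀ → t ≤ ‖z - p‖ →
        n * ((1 - 2 * η) * g) * t ^ 2 ≤ ∑ j, β j * (Metric.infDist (z + t • e j) K
          + Metric.infDist (z + -(t • e j)) K - 2 * Metric.infDist z K) := by
  set C := 1 / 2 * (1 + η⁻¹) * M with hC
  have hC0 : 0 < C := by positivity
  -- The tilt bound makes the error `4 * C * inner ℝ ν (e j) ^ 2` at most `η * c ≤ η * F (e j)`,
  -- which turns `1 - η` into `1 - 2 * η`. The other constants ensure `4 * ‖z - p‖ * C ≤ 1`, `t < δ`
  -- and `2 * C * t ≤ η ^ 2`.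
  refine ⟨√(η * c / (4 * C)), Real.sqrt_pos.2 (by positivity), 1 / (4 * C), by positivity,
    min δ (η ^ 2 / (2 * C)), lt_min hδ (by positivity), ?_⟩
  intro z p hz hpX hzp hzρ e he htilt β hβ hs t ht htt₀ htr
  set ν := ‖z - p‖⁻¹ • (z - p) with hν
  have hν1 : ‖ν‖ = 1 := norm_smul_inv_norm (norm_pos_iff.1 hzp)
  obtain ⟨F, hF, hquad⟩ := H p ⟨hz.mem, hpX⟩ ν hν1 fun y hy => by
    rw [hν, real_inner_smul_left]
    exact mul_nonpos_of_nonneg_of_nonpos (by positivity) (hz.inner_le y hy)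
  have hr : 4 * ‖z - p‖ * C ≤ 1 := by
    rw [le_div_iff₀ (by positivity)] at hzρ
    linarith
  have hstep : ∀ h : E n, ‖h‖ = t → ‖z - p‖ + inner ℝ ν h + 1 / 2 * (1 - η) * F h
      - 2 * C * inner ℝ ν h ^ 2 ≤ Metric.infDist (z + h) K := fun h hh => by
    obtain ⟨y, hy⟩ := exists_isNearest hK hKc ⟨p, hz.mem⟩ (z + h)
    refine hz.quadratic_le hzp hc.le hM.le hF hquad hη (by linarith) hC hr
      (by rw [hh]; exact htt₀.trans_le (min_le_left _ _)) (by rw [hh]; exact htr) ?_ hy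
    have := (htt₀.trans_le (min_le_right _ _)).le
    rw [le_div_iff₀ (by positivity)] at this
    rw [hh]
    linarith
  have hpoint : ∀ j, (1 - 2 * η) * F (e j) * t ^ 2 ≤ Metric.infDist (z + t • e j) K
      + Metric.infDist (z + -(t • e j)) K - 2 * Metric.infDist z K := fun j => by
    have hn : ‖t • e j‖ = t := by rw [norm_smul, he.1 j, mul_one, Real.norm_of_nonneg ht.le]
    have h1 := hstep (t • e j) hn
    have h2 := hstep (-(t • e j)) (by rw [norm_neg, hn])
    have h3 : F (-(t • e j)) = t ^ 2 * F (e j) := by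
      rw [← neg_smul, hF.map_smul]; ring
    rw [h3, inner_neg_right, inner_smul_right] at h2
    rw [hF.map_smul, inner_smul_right] at h1
    have h4 : inner ℝ ν (e j) ^ 2 ≤ η * c / (4 * C) := by
      rw [← Real.sq_sqrt (by positivity : 0 ≤ η * c / (4 * C)), sq_le_sq, abs_of_nonneg
        (Real.sqrt_nonneg (η * c / (4 * C))), hν, real_inner_smul_left, abs_mul, abs_inv, abs_norm,
        inv_mul_le_iff₀ hzp]
      linarith [htilt j]
    have h5 : 4 * C * inner ℝ ν (e j) ^ 2 ≤ η * F (e j) := by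
      have h6 := hF.lower (e j)
      rw [he.1 j] at h6
      rw [le_div_iff₀ (by positivity)] at h4
      have := mul_le_mul_of_nonneg_left h6 hη.le
      linarith
    have h7 := mul_le_mul_of_nonneg_left h5 (sq_nonneg t)
    rw [hz.infDist_eq]
    linarith
  have htrace := mul_le_mul_of_nonneg_left (hF.trace_le e he β hβ hs)
    (mul_nonneg (by linarith : 0 ≤ 1 - 2 * η) (sq_nonneg t))
  calc n * ((1 - 2 * η) * g) * t ^ 2 = (1 - 2 * η) * t ^ 2 * (n * g) := by ring
    _ ≤ _ := htrace
    _ = ∑ j, β j * ((1 - 2 * η) * F (e j) * t ^ 2) := by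
      rw [Finset.mul_sum]
      exact Finset.sum_congr rfl fun j _ => by ring
    _ ≤ _ := Finset.sum_le_sum fun j _ => mul_le_mul_of_nonneg_left (hpoint j) (hβ j).le

end distance

/-! ### Mollification and second differences -/

section mollifier

variable {n : ℕ} {χ : E n → ℝ} {s : ℝ} {F G : E n → ℝ}

namespace ConvexIntersection.IsMollifier

lemma kernel_nonneg (hχ : IsMollifier χ) (hs : 0 < s) (y : E n) : 0 ≤ s ^ (n + 1) * χ (s • y) :=
  mul_nonneg (by positivity) (hχ.nonneg _)

lemma kernel_eq_zero (hχ : IsMollifier χ) (hs : 0 < s) {y : E n} (hy : 1 / s ≤ ‖y‖) :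
    s ^ (n + 1) * χ (s • y) = 0 := by
  rw [hχ.eq_zero, mul_zero]
  rw [mem_ball_zero_iff, norm_smul, Real.norm_of_nonneg hs.le, not_lt]
  rwa [div_le_iff₀ hs, mul_comm] at hy

lemma kernel_hasCompactSupport (hχ : IsMollifier χ) (hs : 0 < s) :
    HasCompactSupport fun y : E n => s ^ (n + 1) * χ (s • y) :=
  HasCompactSupport.intro (isCompact_closedBall (0 : E n) (1 / s)) fun y hy =>
    hχ.kernel_eq_zero hs (by
      rw [mem_closedBall_zero_iff, not_le] at hy
      exact hy.le)

lemma kernel_contDiff (hχ : IsMollifier χ) : ContDiff ℝ ∞ fun y : E n => s ^ (n + 1) * χ (s • y) :=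
  contDiff_const.mul (hχ.smooth.comp (contDiff_id.const_smul s))

lemma integral_kernel (hχ : IsMollifier χ) (hs : 0 < s) :
    ∫ y : E n, s ^ (n + 1) * χ (s • y) = 1 := by
  rw [MeasureTheory.integral_const_mul, MeasureTheory.Measure.integral_comp_smul,
    hχ.integral_eq_one]
  simp only [finrank_euclideanSpace, Fintype.card_fin, smul_eq_mul, mul_one]
  rw [abs_of_pos (by positivity), mul_inv_cancel₀ (by positivity)]

lemma integrable (hχ : IsMollifier χ) (hs : 0 < s) (hF : Continuous F) (x : E n) :
    MeasureTheory.Integrable fun y => F (x - y) * (s ^ (n + 1) * χ (s • y)) := by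
  have hk : Continuous fun y : E n => s ^ (n + 1) * χ (s • y) := hχ.kernel_contDiff.continuous
  exact Continuous.integrable_of_hasCompactSupport ((hF.comp (by fun_prop)).mul hk)
    (hχ.kernel_hasCompactSupport hs).mul_left

lemma mollify_const (hχ : IsMollifier χ) (hs : 0 < s) (c : ℝ) (x : E n) :
    mollify χ (fun _ => c) s x = c := by
  rw [mollify, MeasureTheory.integral_const_mul, hχ.integral_kernel hs, mul_one]

/-- The kernel vanishes outside the ball of radius `1 / s`, so an inequality near `x` is enough;
this is how local estimates for the distance pass to its mollification. -/
lemma mollify_mono (hχ : IsMollifier χ) (hs : 0 < s) (hF : Continuous F) (hG : Continuous G)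
    {x : E n} (h : ∀ z, ‖x - z‖ < 1 / s → F z ≤ G z) : mollify χ F s x ≤ mollify χ G s x := by
  refine MeasureTheory.integral_mono (hχ.integrable hs hF x) (hχ.integrable hs hG x) fun y => ?_
  by_cases hy : ‖y‖ < 1 / s
  · exact mul_le_mul_of_nonneg_right (h _ (by rwa [sub_sub_cancel])) (hχ.kernel_nonneg hs y)
  · simp [hχ.kernel_eq_zero hs (not_lt.1 hy)]

lemma mollify_add (hχ : IsMollifier χ) (hs : 0 < s) (hF : Continuous F) (hG : Continuous G)
    (x : E n) : mollify χ (fun z => F z + G z) s x = mollify χ F s x + mollify χ G s x := by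
  simp only [mollify, add_mul]
  exact MeasureTheory.integral_add (hχ.integrable hs hF x) (hχ.integrable hs hG x)

lemma mollify_sum (hχ : IsMollifier χ) (hs : 0 < s) {ι : Type*} (t : Finset ι) (F : ι → E n → ℝ)
    (hF : ∀ i, Continuous (F i)) (x : E n) :
    mollify χ (fun z => ∑ i ∈ t, F i z) s x = ∑ i ∈ t, mollify χ (F i) s x := by
  simp only [mollify, Finset.sum_mul]
  exact MeasureTheory.integral_finsetSum _ fun i _ => hχ.integrable hs (hF i) x

end ConvexIntersection.IsMollifier

lemma mollify_const_mul (c : ℝ) (x : E n) :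
    mollify χ (fun z => c * F z) s x = c * mollify χ F s x := by
  simp only [mollify, mul_assoc]
  exact MeasureTheory.integral_const_mul _ _

lemma mollify_comp_add (h x : E n) :
    mollify χ (fun z => F (z + h)) s x = mollify χ F s (x + h) := by
  simp only [mollify, sub_add_eq_add_sub]

namespace ConvexIntersection.IsMollifier

lemma contDiff_mollify (hχ : IsMollifier χ) (hs : 0 < s) (hF : Continuous F) :
    ContDiff ℝ ∞ (mollify χ F s) := by
  have h := (hχ.kernel_hasCompactSupport hs).contDiff_convolution_left
    (ContinuousLinearMap.mul ℝ ℝ) (μ := MeasureTheory.volume) (n := ⊤)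
    hχ.kernel_contDiff hF.locallyIntegrable
  convert! h using 1
  ext x
  simp only [mollify, MeasureTheory.convolution, ContinuousLinearMap.mul_apply', mul_comm (F _)]

lemma convexOn_mollify (hχ : IsMollifier χ) (hs : 0 < s) (hF : Continuous F)
    (hFc : ConvexOn ℝ Set.univ F) : ConvexOn ℝ Set.univ (mollify χ F s) := by
  refine ⟨convex_univ, fun x _ x' _ a b ha hb hab => ?_⟩
  have h1 : a • mollify χ F s x + b • mollify χ F s x' =
      ∫ y, (a * F (x - y) + b * F (x' - y)) * (s ^ (n + 1) * χ (s • y)) := by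
    simp only [mollify, smul_eq_mul, add_mul, mul_assoc]
    rw [← MeasureTheory.integral_const_mul, ← MeasureTheory.integral_const_mul,
      ← MeasureTheory.integral_add ((hχ.integrable hs hF x).const_mul a)
        ((hχ.integrable hs hF x').const_mul b)]
  have hi : MeasureTheory.Integrable
      fun y => (a * F (x - y) + b * F (x' - y)) * (s ^ (n + 1) * χ (s • y)) := by
    simp only [add_mul, mul_assoc]
    exact ((hχ.integrable hs hF x).const_mul a).add ((hχ.integrable hs hF x').const_mul b)
  rw [h1]
  refine MeasureTheory.integral_mono (hχ.integrable hs hF _) hi fun y => ?_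
  refine mul_le_mul_of_nonneg_right ?_ (hχ.kernel_nonneg hs y)
  have h2 := hFc.2 (Set.mem_univ (x - y)) (Set.mem_univ (x' - y)) ha hb hab
  have h3 : a • (x - y) + b • (x' - y) = a • x + b • x' - y := by
    have : y = (a + b) • y := by rw [hab, one_smul]
    nth_rewrite 3 [this]
    module
  rwa [h3] at h2

lemma abs_mollify_sub_le (hχ : IsMollifier χ) (hs : 0 < s)
    (hF : ∀ x y, |F x - F y| ≤ ‖x - y‖) (hFc : Continuous F) (x : E n) :
    |mollify χ F s x - F x| ≤ 1 / s := by
  have h1 := hχ.mollify_mono hs hFc (G := fun _ => F x + 1 / s) (by fun_prop) (x := x) fun z hz => by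
    have := (abs_le.1 (hF x z)).1
    linarith
  have h2 := hχ.mollify_mono hs (F := fun _ => F x - 1 / s) (by fun_prop) hFc (x := x) fun z hz => by
    have := (abs_le.1 (hF x z)).2
    linarith
  rw [hχ.mollify_const hs] at h1 h2
  exact abs_le.2 ⟨by linarith, by linarith⟩

lemma mollify_add_le (hχ : IsMollifier χ) (hs : 0 < s)
    (hF : ∀ x y, |F x - F y| ≤ ‖x - y‖) (hFc : Continuous F) (x h : E n) :
    mollify χ F s (x + h) ≤ mollify χ F s x + ‖h‖ := by
  rw [← mollify_comp_add, ← hχ.mollify_const hs ‖h‖ x, ← hχ.mollify_add hs hFc (by fun_prop)]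
  refine hχ.mollify_mono hs (by fun_prop) (by fun_prop) fun z _ => ?_
  have := (abs_le.1 (hF (z + h) z)).2
  rw [add_sub_cancel_left] at this
  linarith

end ConvexIntersection.IsMollifier

lemma le_fderiv_of_eventually {f : E n → ℝ} {x v : E n} {a : ℝ} (hf : DifferentiableAt ℝ f x)
    (h : ∀ᶠ t in 𝓝[>] (0 : ℝ), f x + t * a ≤ f (x + t • v)) : a ≤ fderiv ℝ f x v := by
  have h1 := (hf.hasFDerivAt.hasLineDerivAt v).tendsto_slope_zero_right
  refine ge_of_tendsto h1 ?_
  filter_upwards [h, self_mem_nhdsWithin] with t ht ht0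
  have ht0 : 0 < t := ht0
  rw [smul_eq_mul, inv_mul_eq_div, le_div_iff₀ ht0]
  linarith

lemma fderiv_le_of_eventually {f : E n → ℝ} {x v : E n} {a : ℝ} (hf : DifferentiableAt ℝ f x)
    (h : ∀ᶠ t in 𝓝[>] (0 : ℝ), f (x + t • v) ≤ f x + t * a) : fderiv ℝ f x v ≤ a := by
  have h1 := (hf.hasFDerivAt.hasLineDerivAt v).tendsto_slope_zero_right
  refine le_of_tendsto h1 ?_
  filter_upwards [h, self_mem_nhdsWithin] with t ht ht0
  have ht0 : 0 < t := ht0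
  rw [smul_eq_mul, inv_mul_eq_div, div_le_iff₀ ht0]
  linarith

lemma ConvexOn.fderiv_sub_le {f : E n → ℝ} (hf : ConvexOn ℝ Set.univ f) {x q : E n}
    (hd : DifferentiableAt ℝ f x) : fderiv ℝ f x (q - x) ≤ f q - f x := by
  refine fderiv_le_of_eventually hd ?_
  have h1 : ∀ᶠ t in 𝓝[>] (0 : ℝ), t < 1 := mem_nhdsWithin_of_mem_nhds (Iio_mem_nhds one_pos)
  filter_upwards [h1, self_mem_nhdsWithin] with t ht ht0
  have ht0 : 0 < t := ht0
  have h2 := hf.2 (Set.mem_univ x) (Set.mem_univ q) (by linarith : 0 ≤ 1 - t) ht0.le (by ring)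
  have h3 : (1 - t) • x + t • q = x + t • (q - x) := by module
  rw [h3] at h2
  simp only [smul_eq_mul] at h2
  linarith

/-- The weighted sum of second derivatives is bounded below by bounds for second differences. -/
lemma le_sum_fderiv_fderiv {f : E n → ℝ} {x : E n} (hf : ContDiffAt ℝ 2 f x) {m : ℕ}
    (e : Fin m → E n) (β : Fin m → ℝ) {a : ℝ}
    (h : ∀ᶠ t in 𝓝[>] (0 : ℝ), a * t ^ 2 ≤
      ∑ j, β j * (f (x + t • e j) + f (x + -(t • e j)) - 2 * f x)) :
    a ≤ ∑ j, β j * fderiv ℝ (fderiv ℝ f) x (e j) (e j) := by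
  have hlim : ∀ j, Tendsto (fun t : ℝ => (f (x + t • e j) + f (x + -(t • e j)) - 2 * f x) / t ^ 2)
      (𝓝[>] 0) (𝓝 (fderiv ℝ (fderiv ℝ f) x (e j) (e j))) := by
    intro j
    set b := fderiv ℝ (fderiv ℝ f) x (e j) (e j) with hb
    rw [Metric.tendsto_nhds]
    intro ε hε
    have hη : 0 < ε / (4 * (‖e j‖ ^ 2 + 1)) := by positivity
    obtain ⟨δ, hδ, H⟩ := hf.uniform_taylor_two hη
    have h1 : ∀ᶠ t in 𝓝[>] (0 : ℝ), t < δ / (‖e j‖ + 1) :=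
      mem_nhdsWithin_of_mem_nhds (Iio_mem_nhds (by positivity))
    filter_upwards [h1, self_mem_nhdsWithin] with t ht ht0
    have ht0 : 0 < t := ht0
    have hnorm : ‖t • e j‖ < δ := by
      rw [norm_smul, Real.norm_of_nonneg ht0.le]
      rw [lt_div_iff₀ (by positivity)] at ht
      linarith
    have h2 := abs_le.1 (H x (t • e j) (by simpa using hδ) (by rwa [add_sub_cancel_left]))
    have h3 := abs_le.1 (H x (-(t • e j)) (by simpa using hδ)
      (by rwa [add_sub_cancel_left, norm_neg]))
    rw [norm_neg] at h3
    simp only [map_neg, neg_apply, map_smul, smul_apply, smul_eq_mul, ← hb, norm_smul,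
      mul_pow, Real.norm_eq_abs, sq_abs] at h2 h3
    have h4 : ε / (4 * (‖e j‖ ^ 2 + 1)) * (t ^ 2 * ‖e j‖ ^ 2) ≤ ε / 4 * t ^ 2 := by
      rw [div_mul_eq_mul_div, div_le_iff₀ (by positivity)]
      have : 0 ≤ ε * t ^ 2 := by positivity
      nlinarith
    have ht2 : 0 < t ^ 2 := by positivity
    have h5 : 0 < ε * t ^ 2 := by positivity
    rw [Real.dist_eq, div_sub' ht2.ne', abs_div, abs_of_pos ht2, div_lt_iff₀ ht2, abs_lt]
    constructor <;> linarith [h2.1, h2.2, h3.1, h3.2]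
  have hsum : Tendsto (fun t : ℝ => ∑ j, β j *
      ((f (x + t • e j) + f (x + -(t • e j)) - 2 * f x) / t ^ 2)) (𝓝[>] 0)
      (𝓝 (∑ j, β j * fderiv ℝ (fderiv ℝ f) x (e j) (e j))) :=
    tendsto_finsetSum _ fun j _ => (hlim j).const_mul (β j)
  refine ge_of_tendsto hsum ?_
  filter_upwards [h, self_mem_nhdsWithin] with t ht ht0
  have ht2 : 0 < t ^ 2 := by
    have ht0 : 0 < t := ht0
    positivity
  simp only [mul_div_assoc']
  rwa [← Finset.sum_div, le_div_iff₀ ht2]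

end mollifier

/-! ### Level sets of the mollified distance -/

section levelSets

variable {n : ℕ} {K : Set (E n)} {χ : E n → ℝ}

/-- Directions in which the mollified distance function does not increase are almost tangential
for the distance function at all nearby points. -/
lemma inner_nearest_le_of_fderiv_nonpos (hχ : IsMollifier χ) (hK : IsCompact K)
    (hKc : Convex ℝ K) (hne : K.Nonempty) {x e : E n} {s r τ : ℝ} (hs : 0 < s) (hr : 0 < r)
    (hτ : 0 < τ) (hsr : 16 / s ≤ τ * r)
    (hd : ∀ z, ‖x - z‖ < 1 / s → r / 2 ≤ Metric.infDist z K ∧ Metric.infDist z K ≤ 2 * r)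
    (he : ‖e‖ = 1)
    (hder : fderiv ℝ (mollify χ (fun z => Metric.infDist z K) s) x e ≤ 0) {z p : E n}
    (hz : ‖x - z‖ < 1 / s) (hp : IsNearest K z p) : inner ℝ (z - p) e ≤ τ * ‖z - p‖ := by
  by_contra hlt
  rw [not_le] at hlt
  have hdc : Continuous fun z : E n => Metric.infDist z K := Metric.continuous_infDist_pt K
  have hzr := (hd z hz).1
  rw [hp.infDist_eq] at hzr
  have hτr : τ * (r / 2) ≤ τ * ‖z - p‖ := mul_le_mul_of_nonneg_left hzr hτ.le
  have hs16 : 16 / s = 16 * (1 / s) := by ring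
  -- The vector from the nearest point is 2-Lipschitz and `y`, `z` are less than `2 / s` apart, so
  -- the inner product drops from at least `τ * r / 2` by at most `4 / s ≤ τ * r / 4`. Division by a
  -- distance of at most `2 * r` leaves the slope `τ / 8`.
  have hgrow : ∀ y, ‖x - y‖ < 1 / s → ∀ t, 0 < t →
      Metric.infDist y K + t * (τ / 8) ≤ Metric.infDist (y + t • e) K := by
    intro y hy t ht
    obtain ⟨p', hp'⟩ := exists_isNearest hK hKc hne y
    obtain ⟨p'', hp''⟩ := exists_isNearest hK hKc hne (y + t • e)
    have h1 := hp'.le_infDist hp''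
    rw [add_sub_cancel_left, inner_smul_right] at h1
    have hzy : ‖y - z‖ < 2 * (1 / s) := by
      have : y - z = (x - z) - (x - y) := by abel
      rw [this]
      exact (norm_sub_le _ _).trans_lt (by linarith)
    have h2 : ‖(z - p) - (y - p')‖ ≤ 4 * (1 / s) := by
      have h3 : (z - p) - (y - p') = (p' - p) - (y - z) := by abel
      rw [h3]
      refine (norm_sub_le _ _).trans ?_
      linarith [hp.norm_sub_le hp']
    have h4 : inner ℝ (z - p) e - inner ℝ (y - p') e ≤ 4 * (1 / s) := by
      rw [← inner_sub_left]
      refine (real_inner_le_norm _ _).trans ?_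
      rwa [he, mul_one]
    have h5 : τ * r / 4 ≤ inner ℝ (y - p') e := by linarith
    obtain ⟨h6, h7⟩ := hd y hy
    rw [hp'.infDist_eq] at h6 h7 ⊢
    have h8 : ‖y - p'‖ * (τ / 8) ≤ inner ℝ (y - p') e := by
      have := mul_le_mul_of_nonneg_right h7 (by positivity : 0 ≤ τ / 8)
      linarith
    have h9 := mul_le_mul_of_nonneg_left h8 ht.le
    have h10 : 0 < ‖y - p'‖ := by linarith
    refine le_of_mul_le_mul_left ?_ h10
    linarith
  have h1 : τ / 8 ≤ fderiv ℝ (mollify χ (fun z => Metric.infDist z K) s) x e := by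
    refine le_fderiv_of_eventually
      ((hχ.contDiff_mollify hs hdc).contDiffAt.differentiableAt (by simp)) ?_
    filter_upwards [self_mem_nhdsWithin] with t ht
    have ht : 0 < t := ht
    rw [← mollify_comp_add, ← hχ.mollify_const hs (t * (τ / 8)) x,
      ← hχ.mollify_add hs hdc (by fun_prop)]
    exact hχ.mollify_mono hs (by fun_prop) (by fun_prop) fun y hy => hgrow y hy t ht
  linarith

/-- The boundary of a sublevel set of a convex function above its minimum. -/
lemma ConvexOn.frontier_sublevel {f : E n → ℝ} (hf : ConvexOn ℝ Set.univ f) (hc : Continuous f)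
    {q : E n} {r : ℝ} (hq : f q < r) : frontier {y | f y ≤ r} = {y | f y = r} := by
  refine Set.Subset.antisymm (frontier_le_subset_eq hc continuous_const) fun x hx => ?_
  have hx : f x = r := hx
  refine ⟨subset_closure hx.le, fun hxi => ?_⟩
  -- Were `x` interior, the sublevel set would contain a point beyond `x` on the ray from `q`, and
  -- convexity would give `f x < r`.
  have h1 : Tendsto (fun t : ℝ => x + t • (x - q)) (𝓝[>] 0) (𝓝 x) := by
    have : Continuous fun t : ℝ => x + t • (x - q) := by fun_prop
    have h2 := this.tendsto 0
    simp only [zero_smul, add_zero] at h2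
    exact h2.mono_left nhdsWithin_le_nhds
  obtain ⟨t, ht, ht0⟩ :=
    ((h1.eventually (mem_interior_iff_mem_nhds.1 hxi)).and self_mem_nhdsWithin).exists
  have ht0 : 0 < t := ht0
  have ht : f (x + t • (x - q)) ≤ r := ht
  have h1t : 0 < 1 + t := by linarith
  have h2 := hf.2 (Set.mem_univ (x + t • (x - q))) (Set.mem_univ q)
    (by positivity : 0 ≤ 1 / (1 + t)) (by positivity : 0 ≤ t / (1 + t)) (by field_simp)
  have h3 : (1 / (1 + t)) • (x + t • (x - q)) + (t / (1 + t)) • q = x := by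
    have : (1 / (1 + t)) • (x + t • (x - q)) + (t / (1 + t)) • q = ((1 + t) / (1 + t)) • x := by
      simp only [div_eq_mul_inv, one_mul]
      module
    rw [this, div_self h1t.ne', one_smul]
  rw [h3, hx, smul_eq_mul, smul_eq_mul, ← mul_le_mul_iff_right₀ h1t] at h2
  have h4 : (1 + t) * (1 / (1 + t) * f (x + t • (x - q)) + t / (1 + t) * f q)
      = f (x + t • (x - q)) + t * f q := by field_simp
  rw [h4] at h2
  nlinarith

lemma exists_pow_ge {k ε g : ℝ} (hε : 0 < ε) (hg : g ^ n = k) :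
    ∃ η : ℝ, 0 < η ∧ 2 * η < 1 ∧ k - ε ≤ ((1 - 2 * η) * ((1 - η) * g)) ^ n := by
  have h1 : Tendsto (fun η : ℝ => ((1 - 2 * η) * ((1 - η) * g)) ^ n) (𝓝[>] 0) (𝓝 k) := by
    have : Continuous fun η : ℝ => ((1 - 2 * η) * ((1 - η) * g)) ^ n := by fun_prop
    have h2 := this.tendsto 0
    simp only [mul_zero, sub_zero, one_mul, hg] at h2
    exact h2.mono_left nhdsWithin_le_nhds
  have h3 : ∀ᶠ η in 𝓝[>] (0 : ℝ), η < 1 / 2 :=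
    mem_nhdsWithin_of_mem_nhds (Iio_mem_nhds (by norm_num))
  obtain ⟨η, hη1, hη2, hη3⟩ :=
    ((h1.eventually_const_lt (by linarith : k - ε < k)).and (h3.and self_mem_nhdsWithin)).exists
  exact ⟨η, hη3, by linarith, hη1.le⟩

lemma abs_infDist_sub_le (K : Set (E n)) (x y : E n) :
    |Metric.infDist x K - Metric.infDist y K| ≤ ‖x - y‖ := by
  rw [abs_sub_le_iff]
  constructor
  · have := Metric.infDist_le_infDist_add_dist (s := K) (x := x) (y := y)
    rw [dist_eq_norm] at this
    linarith
  · have := Metric.infDist_le_infDist_add_dist (s := K) (x := y) (y := x)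
    rw [dist_eq_norm, norm_sub_rev] at this
    linarith

/-- A level set of the mollified distance function is a smooth hypersurface. -/
lemma isSmoothHypersurfaceNear_level {f : E n → ℝ} (hf : ContDiff ℝ ∞ f) {x : E n} {r : ℝ}
    (h : fderiv ℝ f x ≠ 0) : IsSmoothHypersurfaceNear {y | f y = r} x := by
  have hcont : Continuous (fderiv ℝ f) := hf.continuous_fderiv (by simp)
  refine ⟨{y | fderiv ℝ f y ≠ 0}, isOpen_ne_fun hcont continuous_const, h, fun y => f y - r,
    (hf.sub contDiff_const).contDiffOn, fun y hy => ?_, ?_⟩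
  · rwa [fderiv_sub_const]
  · ext y
    simp [sub_eq_zero, and_comm]

/-- Lower bounds for weighted traces of the second derivative of a convex function bound the
Gaussian curvature of its level sets from below. -/
lemma pow_le_gaussianCurvature_level (hn : 1 ≤ n) {f : E n → ℝ} (hf : ContDiff ℝ ∞ f)
    (hfc : ConvexOn ℝ Set.univ f) (hlip : ∀ x h, f (x + h) ≤ f x + ‖h‖) {x q : E n} {r g : ℝ}
    (hq : f q < r) (hx : f x = r) (hg : 0 ≤ g)
    (h : ∀ e : Fin n → E n, Orthonormal ℝ e → (∀ j, fderiv ℝ f x (e j) = 0) →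
      ∀ β : Fin n → ℝ, (∀ j, 0 < β j) → ∑ j, Real.log (β j) = 0 →
      n * g ≤ ∑ j, β j * fderiv ℝ (fderiv ℝ f) x (e j) (e j)) :
    g ^ n ≤ gaussianCurvature {y | f y = r} (outwardNormal {y | f y ≤ r}) x := by
  set L := {y | f y ≤ r} with hL
  have hfront : frontier L = {y | f y = r} := hfc.frontier_sublevel hf.continuous hq
  have hLc : IsClosed L := isClosed_le hf.continuous continuous_const
  have hLconv : Convex ℝ L := by
    have := hfc.convex_le r
    simpa [hL] using this
  have hqi : q ∈ interior L :=
    interior_maximal (fun y hy => le_of_lt hy) (isOpen_lt hf.continuous continuous_const) hq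
  have hdiff : DifferentiableAt ℝ f x := hf.contDiffAt.differentiableAt (by simp)
  have hneg : fderiv ℝ f x (q - x) < 0 :=
    (hfc.fderiv_sub_le hdiff).trans_lt (by rw [hx]; linarith)
  have hf2 : ContDiff ℝ 2 f := hf.of_le (WithTop.coe_le_coe.2 (le_top : (2 : ℕ∞) ≤ ⊤))
  set F : E n → ℝ := fun y => f y - r with hF
  have hfd : fderiv ℝ F = fderiv ℝ f := by
    ext1 y
    exact fderiv_sub_const r
  have heq : IsLocalEquation (frontier L) F x := by
    refine ⟨(hf2.sub contDiff_const).contDiffAt, ?_, ?_⟩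
    · rw [hfd]
      intro h0
      rw [h0] at hneg
      simp at hneg
    · rw [hfront]
      exact Eventually.of_forall fun y => by simp [hF, sub_eq_zero]
  have hxf : x ∈ frontier L := by rw [hfront]; exact hx
  have hqx : fderiv ℝ F x (q - x) < 0 := by rwa [hfd]
  have hν : ∀ᶠ y in 𝓝 x, y ∈ frontier L →
      outwardNormal L y = ‖gradient F y‖⁻¹ • gradient F y := by
    filter_upwards [heq.eventually, heq.eventually_fderiv_neg hqx] with y hy hyq hyS
    exact hy.outwardNormal_eq hLconv hLc hqi hyS hyq
  obtain ⟨e, he, heG, hdet, -, -⟩ := exists_principal_basis heq hxf hν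
  rw [← hfront, hdet]
  have hG0 : 0 < ‖gradient F x‖ := norm_pos_iff.2 heq.gradient_ne_zero
  have hG1 : ‖gradient F x‖ ≤ 1 := by
    have h1 : fderiv ℝ f x (gradient F x) ≤ ‖gradient F x‖ := by
      refine fderiv_le_of_eventually hdiff ?_
      filter_upwards [self_mem_nhdsWithin] with t ht
      have := hlip x (t • gradient F x)
      rwa [norm_smul, Real.norm_of_nonneg (le_of_lt ht)] at this
    rw [← hfd, IsLocalEquation.fderiv_apply, real_inner_self_eq_norm_sq] at h1
    nlinarith
  have hpos : ∀ j, 0 ≤ fderiv ℝ (fderiv ℝ F) x (e j) (e j) := fun j =>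
    heq.hessian_nonneg hLconv hLc hqi hxf hqx (heG j)
  -- The gradient has norm at most one, so dividing the nonnegative second derivatives by it can
  -- only increase them.
  refine (pow_le_prod_of_trace_le hn hg _ hpos fun β hβ hs => ?_).trans
    (Finset.prod_le_prod (fun j _ => hpos j) fun j _ =>
      le_mul_of_one_le_left (hpos j) ((one_le_inv₀ hG0).2 hG1))
  rw [hfd]
  exact h e he (fun j => by rw [← hfd, IsLocalEquation.fderiv_apply, heG]) β hβ hs

end levelSets

/-! ### Choice of the constants and conclusion -/

theorem theorem6p34 (n : ℕ) (hn : 1 ≤ n) (χ : E n → ℝ) (hχ : IsMollifier χ)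
    (K₁ K₂ U : Set (E n))
    (hK₁ : IsCompact K₁) (hK₁' : Convex ℝ K₁) (hK₂ : IsCompact K₂) (hK₂' : Convex ℝ K₂)
    (hK : (interior (K₁ ∩ K₂)).Nonempty) (hU : IsOpen U) (k : ℝ) (hk : 0 < k)
    (h₁ : ∀ x ∈ U ∩ frontier K₁, IsSmoothHypersurfaceNear (frontier K₁) x ∧
      k ≤ gaussianCurvature (frontier K₁) (outwardNormal K₁) x)
    (h₂ : ∀ x ∈ U ∩ frontier K₂, IsSmoothHypersurfaceNear (frontier K₂) x ∧
      k ≤ gaussianCurvature (frontier K₂) (outwardNormal K₂) x)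
    (d : ℝ → E n → ℝ)
    (hd : d = mollify χ (fun x => Metric.infDist x (K₁ ∩ K₂)))
    (X : Set (E n)) (hX : IsCompact X) (hXU : X ⊆ U) (ε : ℝ) (hε : 0 < ε) :
    ∃ ρ > 0, ∀ r, 0 < r → r < ρ → ∃ S > 0, ∀ s, S < s →
      (∀ x ∈ X, d s x = r →
        IsSmoothHypersurfaceNear {y | d s y = r} x ∧
        k - ε ≤ gaussianCurvature {y | d s y = r} (outwardNormal {y | d s y ≤ r}) x) ∧
      (IsCompact {y | d s y ≤ r} ∧ Convex ℝ {y | d s y ≤ r} ∧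
        frontier {y | d s y ≤ r} = {y | d s y = r} ∧
        K₁ ∩ K₂ ⊆ {y | d s y ≤ r} ∧
        Metric.hausdorffDist (K₁ ∩ K₂) {y | d s y ≤ r} ≤ 2 * r) := by
  set K := K₁ ∩ K₂ with hKdef
  have hKcomp : IsCompact K := hK₁.inter hK₂
  have hKconv : Convex ℝ K := hK₁'.inter hK₂'
  have hKne : K.Nonempty := hK.mono interior_subset
  have hn0 : n ≠ 0 := by omega
  obtain ⟨g, hg, hgn⟩ : ∃ g : ℝ, 0 < g ∧ g ^ n = k :=
    ⟨k ^ ((n : ℝ)⁻¹), Real.rpow_pos_of_pos hk _, Real.rpow_inv_natCast_pow hk.le hn0⟩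
  obtain ⟨η, hη, hη1, hηk⟩ := exists_pow_ge (n := n) hε hgn
  obtain ⟨ρ₀, hρ₀, hρ₀U⟩ := hX.exists_cthickening_subset_open hU hXU
  have hX' : IsCompact (Metric.cthickening ρ₀ X) := hX.cthickening
  have hQ₁ := hasQuadrics_of_isCompact hn hK₁' hK₁.isClosed
    (hK.mono (interior_mono Set.inter_subset_left)) hg (by rwa [hgn]) hX' hρ₀U hη
    (by linarith : η < 1)
  have hQ₂ := hasQuadrics_of_isCompact hn hK₂' hK₂.isClosed
    (hK.mono (interior_mono Set.inter_subset_right)) hg (by rwa [hgn]) hX' hρ₀U hη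
    (by linarith : η < 1)
  have hg₁ : 0 ≤ (1 - η) * g := mul_nonneg (by linarith) hg.le
  obtain ⟨c, hc, M, hM, δ, hδ, hquad⟩ := hQ₁.inter hg₁ hQ₂ hK₁' hK₂' hK hKcomp.isBounded
  obtain ⟨τ, hτ, ρ₁, hρ₁, t₀, ht₀, htrace⟩ :=
    trace_second_difference hKcomp hKconv hc hM hδ hquad hη hη1
  -- The quadric is taken at the nearest point of some `z` within `1 / s` of `x`, not at `x`. That
  -- point is within `3 * r` of `x`, hence in the thickening of `X`, and its distance from `z` is at
  -- most `2 * r`.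
  refine ⟨min (ρ₀ / 3) (ρ₁ / 2), lt_min (by linarith) (by linarith), fun r hr hrρ => ?_⟩
  have hrρ₀ : 3 * r < ρ₀ := by linarith [hrρ.trans_le (min_le_left _ _)]
  have hrρ₁ : 2 * r < ρ₁ := by linarith [hrρ.trans_le (min_le_right _ _)]
  -- The first term gives `1 / s ≤ r / 4`, which keeps the distance between `r / 2` and `2 * r` on
  -- the ball of radius `1 / s` about `x`; the second is the smallness needed for almost tangential
  -- frames.
  refine ⟨4 / r + 16 / (τ * r), by positivity, fun s hsS => ?_⟩
  have hs : 0 < s := lt_trans (by positivity) hsS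
  have hs4 : 1 / s ≤ r / 4 := by
    have : 4 / r < s := lt_of_le_of_lt (le_add_of_nonneg_right (by positivity)) hsS
    rw [div_lt_iff₀ hr] at this
    rw [div_le_iff₀ hs]
    linarith
  have hs16 : 16 / s ≤ τ * r := by
    have : 16 / (τ * r) < s := lt_of_le_of_lt (le_add_of_nonneg_left (by positivity)) hsS
    rw [div_lt_iff₀ (by positivity)] at this
    rw [div_le_iff₀ hs]
    linarith
  set φ : E n → ℝ := fun z => Metric.infDist z K with hφ
  have hφc : Continuous φ := Metric.continuous_infDist_pt K
  have hφlip : ∀ x y, |φ x - φ y| ≤ ‖x - y‖ := abs_infDist_sub_le K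
  have hφconv : ConvexOn ℝ Set.univ φ := convexOn_infDist hKcomp hKconv hKne
  set D : E n → ℝ := d s with hD
  have hDm : D = mollify χ φ s := by rw [hD, hd]
  have hDsmooth : ContDiff ℝ ∞ D := hDm ▸ hχ.contDiff_mollify hs hφc
  have hDconv : ConvexOn ℝ Set.univ D := hDm ▸ hχ.convexOn_mollify hs hφc hφconv
  have hDφ : ∀ x, |D x - φ x| ≤ 1 / s := hDm ▸ hχ.abs_mollify_sub_le hs hφlip hφc
  have hDlip : ∀ x h, D (x + h) ≤ D x + ‖h‖ := hDm ▸ hχ.mollify_add_le hs hφlip hφc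
  have hDK : ∀ y ∈ K, D y < r := fun y hy => by
    have h3 : φ y = 0 := Metric.infDist_zero_of_mem hy
    have := (abs_le.1 (hDφ y)).2
    linarith
  have hφD : ∀ y, D y ≤ r → φ y ≤ 2 * r := fun y hy => by
    have := (abs_le.1 (hDφ y)).1
    linarith
  obtain ⟨q, hq⟩ := hKne
  refine ⟨fun x hxX hxr => ⟨?_, ?_⟩, ?_, ?_, hDconv.frontier_sublevel hDsmooth.continuous (hDK q hq),
    fun y hy => (hDK y hy).le, ?_⟩
  · refine isSmoothHypersurfaceNear_level hDsmooth fun h0 => ?_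
    have h3 := hDconv.fderiv_sub_le (q := q) (hDsmooth.contDiffAt.differentiableAt (x := x) (by simp))
    rw [h0, hxr] at h3
    have := hDK q hq
    simp at h3
    linarith
  · refine hηk.trans (pow_le_gaussianCurvature_level hn hDsmooth hDconv hDlip (hDK q hq) hxr
      (mul_nonneg (by linarith) hg₁) fun e he heD β hβ hβs => ?_)
    have hball : ∀ z, ‖x - z‖ < 1 / s → r / 2 ≤ φ z ∧ φ z ≤ 2 * r := fun z hz => by
      have h3 := abs_le.1 (hDφ x)
      have h4 := abs_le.1 (hφlip x z)
      rw [hxr] at h3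
      exact ⟨by linarith, by linarith⟩
    have htilt : ∀ z p, ‖x - z‖ < 1 / s → IsNearest K z p → ∀ j,
        |inner ℝ (z - p) (e j)| ≤ τ * ‖z - p‖ := fun z p hz hp j => by
      refine abs_le'.2 ⟨?_, ?_⟩
      · refine inner_nearest_le_of_fderiv_nonpos hχ hKcomp hKconv ⟨q, hq⟩ hs hr hτ hs16 hball
          (he.1 j) ?_ hz hp
        rw [← hDm, heD]
      · rw [← inner_neg_right]
        refine inner_nearest_le_of_fderiv_nonpos hχ hKcomp hKconv ⟨q, hq⟩ hs hr hτ hs16 hball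
          (by rw [norm_neg, he.1 j]) ?_ hz hp
        rw [← hDm, map_neg, heD, neg_zero]
    refine le_sum_fderiv_fderiv
      (hDsmooth.of_le (WithTop.coe_le_coe.2 (le_top : (2 : ℕ∞) ≤ ⊤))).contDiffAt e β ?_
    have hsmall : ∀ᶠ t in 𝓝[>] (0 : ℝ), t < min t₀ (r / 2) :=
      mem_nhdsWithin_of_mem_nhds (Iio_mem_nhds (lt_min ht₀ (by linarith)))
    filter_upwards [hsmall, self_mem_nhdsWithin] with t ht ht0
    have ht0 : 0 < t := ht0
    -- The frame and the weights do not depend on `z`, so the weighted trace of second differences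
    -- commutes with mollification.
    have hmoll : ∑ j, β j * (D (x + t • e j) + D (x + -(t • e j)) - 2 * D x) =
        mollify χ (fun z => ∑ j, β j * ((φ (z + t • e j) + φ (z + -(t • e j))) + -2 * φ z)) s x := by
      rw [hχ.mollify_sum hs _ _ (fun j => by fun_prop)]
      refine Finset.sum_congr rfl fun j _ => ?_
      rw [mollify_const_mul, hχ.mollify_add hs (by fun_prop) (by fun_prop),
        hχ.mollify_add hs (by fun_prop) (by fun_prop), mollify_const_mul, mollify_comp_add,
        mollify_comp_add, hDm]
      ring
    rw [hmoll, ← hχ.mollify_const hs (n * ((1 - 2 * η) * ((1 - η) * g)) * t ^ 2) x]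
    refine hχ.mollify_mono hs (by fun_prop) (by fun_prop) fun z hz => ?_
    obtain ⟨p, hp⟩ := exists_isNearest hKcomp hKconv ⟨q, hq⟩ z
    obtain ⟨hz1, hz2⟩ := hball z hz
    have hzφ : φ z = ‖z - p‖ := hp.infDist_eq
    have hpX : p ∈ Metric.cthickening ρ₀ X := by
      refine Metric.mem_cthickening_of_dist_le p x ρ₀ X hxX ?_
      rw [dist_comm, dist_eq_norm]
      have : x - p = (x - z) + (z - p) := by abel
      rw [this]
      refine (norm_add_le _ _).trans ?_
      linarith
    have h3 := htrace z p hp hpX (by linarith) (by linarith) e he (htilt z p hz hp) β hβ hβs t ht0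
      (ht.trans_le (min_le_left _ _)) (by linarith [ht.trans_le (min_le_right t₀ (r / 2))])
    refine h3.trans (le_of_eq (Finset.sum_congr rfl fun j _ => ?_))
    simp only [hφ]
    ring
  · refine Metric.isCompact_of_isClosed_isBounded
      (isClosed_le hDsmooth.continuous continuous_const) ?_
    refine (hKcomp.isBounded.cthickening (δ := 2 * r)).subset fun y hy => ?_
    obtain ⟨p, hp⟩ := exists_isNearest hKcomp hKconv ⟨q, hq⟩ y
    refine Metric.mem_cthickening_of_dist_le y p _ _ hp.mem ?_
    rw [dist_eq_norm, ← hp.infDist_eq]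
    exact hφD y hy
  · simpa using hDconv.convex_le r
  · refine Metric.hausdorffDist_le_of_infDist (by linarith) (fun y hy => ?_) fun y hy => hφD y hy
    have hyD : y ∈ {y | D y ≤ r} := (hDK y hy).le
    rw [Metric.infDist_zero_of_mem hyD]
    linarith
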